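/- Let $K$ be a field, let $n\ge 0$, let $A=(a_{i,j})_{1\le i,j\le n}$ be an $n\times n$ matrix over $K$, and let $\lambda=(\lambda_a)_{a\in\mathbb Z}$, $\mu=(\mu_a)_{a\in\mathbb Z}$ be sequences in $K$. Let $s$ be the shift $(s\lambda)_a=\lambda_{a+1}$, with inverse $(s^{-1}\lambda)_a=\lambda_{a-1}$, and let $A_{i_1,\dots,i_k}^{j_1,\dots,j_k}$ be the matrix obtained from $A$ by erasing rows $i_1,\dots,i_k$ and columns $j_1,\dots,j_k$. The generalized Lambda-determinant $|A|_{\lambda,\mu}$ is defined inductively on the size: it is $1$ for the $0\times 0$ matrix, $a$ for the $1\times1$ matrix $(a)$, and for $n\ge 2$ $$|A|_{\lambda,\mu}=\frac{\mu_0\,|A_1^1|_{\lambda,s\mu}\,|A_n^n|_{\lambda,s^{-1}\mu}+\lambda_0\,|A_1^n|_{s^{-1}\lambda,\mu}\,|A_n^1|_{s\lambda,\mu}}{|A_{1,n}^{1,n}|_{\lambda,\mu}}.$$ The definition makes sense for $(A,\lambda,\mu)$ if no denominator occurring in this recursion, at any depth, is zero. An alternating sign matrix (ASM) is a square matrix with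 entries in $\{0,1,-1\}$ such that every row and every column has sum $1$ and its nonzero entries alternate in sign. For an $n\times n$ ASM $B=(b_{i,j})$ and an integer $a$, let $I_a(B)$ be the number of zero entries $b_{i,j}$ with $j-i=a$ such that the first nonzero entry to the right of $b_{i,j}$ in its row and the first nonzero entry below it in its column both exist and equal $1$; let $I'_a(B)$ be the number of zero entries $b_{i,j}$ with $i+j-n-1=a$ such that the first nonzero entry to the right in the row and the first nonzero entry above in the column both exist and equal $1$. Put $$F(A,\lambda,\mu)=\sum_{B\ n\times n\ \mathrm{ASM}}\ \prod_{a=2-n}^{n-2}\lambda_a^{I_a(B)}\mu_a^{I'_a(B)}\ \prod_{i,j=1}^n a_{i,j}^{b_{i,j}}\,(\lambda_{j-i}+\mu_{i+j-n-1})^{\delta_{b_{i,j},-1}}.$$ Theorem. (1) Whenever the definition of $|A|_{\lambda,\mu}$ makes sense, $|A|_{\lambda,\mu}=F(A,\lambda,\mu)$. (2) The definition makes sense when all $a_{i,j}$, $\lambda_a$, $\mu_a$ are independent indeterminates over $K$, and then $|A|_{\lambda,\mu}=F(A,\lambda,\mu)$ as rational functions. (3) The rational function $|A|_{\lambda,\mu}$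 of (2) is regular at every point $(A,\lambda,\mu)$ over $K$ with $a_{i,j}\neq 0$ for all $2\le i,j\le n-1$, and its value there is $F(A,\lambda,\mu)$. -/

import Mathlib

namespace LambdaDet

/-- The shift operator on sequences: `(s x)_a = x_{a+1}`. -/
def shift {K : Type*} (x : ℤ → K) : ℤ → K := fun a => x (a + 1)

/-- The inverse shift operator on sequences: `(s⁻¹ x)_a = x_{a-1}`. -/
def unshift {K : Type*} (x : ℤ → K) : ℤ → K := fun a => x (a - 1)

/-- Erase the first row and the first column. -/
def eraseFF {K : Type*} {n : ℕ} (A : Matrix (Fin (n + 1)) (Fin (n + 1)) K) :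
    Matrix (Fin n) (Fin n) K := A.submatrix Fin.succ Fin.succ

/-- Erase the last row and the last column. -/
def eraseLL {K : Type*} {n : ℕ} (A : Matrix (Fin (n + 1)) (Fin (n + 1)) K) :
    Matrix (Fin n) (Fin n) K := A.submatrix Fin.castSucc Fin.castSucc

/-- Erase the first row and the last column. -/
def eraseFL {K : Type*} {n : ℕ} (A : Matrix (Fin (n + 1)) (Fin (n + 1)) K) :
    Matrix (Fin n) (Fin n) K := A.submatrix Fin.succ Fin.castSucc

/-- Erase the last row and the first column. -/
def eraseLF {K : Type*} {n : ℕ} (A : Matrix (Fin (n + 1)) (Fin (n + 1)) K) :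
    Matrix (Fin n) (Fin n) K := A.submatrix Fin.castSucc Fin.succ

/-- The generalized Lambda-determinant, by the modified Dodgson condensation. -/
def lambdaDet {K : Type*} [Field K] :
    (n : ℕ) → Matrix (Fin n) (Fin n) K → (ℤ → K) → (ℤ → K) → K
  | 0, _, _, _ => 1
  | 1, A, _, _ => A 0 0
  | n + 2, A, l, m =>
      (m 0 * lambdaDet (n + 1) (eraseFF A) l (shift m)
            * lambdaDet (n + 1) (eraseLL A) l (unshift m)
        + l 0 * lambdaDet (n + 1) (eraseFL A) (unshift l) m
            * lambdaDet (n + 1) (eraseLF A) (shift l) m)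
        / lambdaDet n (eraseLL (eraseFF A)) l m

/-- The recursion defining `lambdaDet n A l m` makes sense: no denominator that occurs in it, at
any depth, vanishes. -/
def IsDefined {K : Type*} [Field K] :
    (n : ℕ) → Matrix (Fin n) (Fin n) K → (ℤ → K) → (ℤ → K) → Prop
  | 0, _, _, _ => True
  | 1, _, _, _ => True
  | n + 2, A, l, m =>
      IsDefined (n + 1) (eraseFF A) l (shift m) ∧
      IsDefined (n + 1) (eraseLL A) l (unshift m) ∧
      IsDefined (n + 1) (eraseFL A) (unshift l) m ∧
      IsDefined (n + 1) (eraseLF A) (shift l) m ∧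
      IsDefined n (eraseLL (eraseFF A)) l m ∧
      lambdaDet n (eraseLL (eraseFF A)) l m ≠ 0

/-- Alternating sign matrices: entries in `{0, 1, -1}` (built into `SignType`), every row and every
column sums to `1`, and its partial sums lie in `{0, 1}` (that is, its nonzero entries alternate in
sign, starting with `1`). -/
def IsASM {n : ℕ} (B : Matrix (Fin n) (Fin n) SignType) : Prop :=
  (∀ i, ∑ j, (B i j : ℤ) = 1) ∧
  (∀ j, ∑ i, (B i j : ℤ) = 1) ∧
  (∀ i k, 0 ≤ ∑ j ∈ Finset.univ.filter (· ≤ k), (B i j : ℤ) ∧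
    ∑ j ∈ Finset.univ.filter (· ≤ k), (B i j : ℤ) ≤ 1) ∧
  (∀ j k, 0 ≤ ∑ i ∈ Finset.univ.filter (· ≤ k), (B i j : ℤ) ∧
    ∑ i ∈ Finset.univ.filter (· ≤ k), (B i j : ℤ) ≤ 1)

instance {n : ℕ} : DecidablePred (IsASM (n := n)) := fun B => by
  unfold IsASM; infer_instance

/-- The first nonzero entry strictly to the right of `(i, j)` exists and is `1`. -/
def RightIsOne {n : ℕ} (B : Matrix (Fin n) (Fin n) SignType) (i j : Fin n) : Prop :=
  ∃ k, j < k ∧ B i k = 1 ∧ ∀ k', j < k' → k' < k → B i k' = 0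

/-- The first nonzero entry strictly below `(i, j)` exists and is `1`. -/
def BelowIsOne {n : ℕ} (B : Matrix (Fin n) (Fin n) SignType) (i j : Fin n) : Prop :=
  ∃ k, i < k ∧ B k j = 1 ∧ ∀ k', i < k' → k' < k → B k' j = 0

/-- The first nonzero entry strictly above `(i, j)` (going up) exists and is `1`. -/
def AboveIsOne {n : ℕ} (B : Matrix (Fin n) (Fin n) SignType) (i j : Fin n) : Prop :=
  ∃ k, k < i ∧ B k j = 1 ∧ ∀ k', k < k' → k' < i → B k' j = 0

instance {n : ℕ} (B : Matrix (Fin n) (Fin n) SignType) (i j : Fin n) :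
    Decidable (RightIsOne B i j) := by unfold RightIsOne; infer_instance

instance {n : ℕ} (B : Matrix (Fin n) (Fin n) SignType) (i j : Fin n) :
    Decidable (BelowIsOne B i j) := by unfold BelowIsOne; infer_instance

instance {n : ℕ} (B : Matrix (Fin n) (Fin n) SignType) (i j : Fin n) :
    Decidable (AboveIsOne B i j) := by unfold AboveIsOne; infer_instance

/-- The index `j - i` of the diagonal through `(i, j)`. -/
def diagIdx {n : ℕ} (i j : Fin n) : ℤ := (j : ℤ) - (i : ℤ)

/-- The index `i + j - n - 1` of the antidiagonal through `(i, j)`, for rows and columns numbered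
from `1`; elements of `Fin n` are numbered from `0`. -/
def antiIdx {n : ℕ} (i j : Fin n) : ℤ := ((i : ℤ) + 1) + ((j : ℤ) + 1) - (n : ℤ) - 1

/-- `I_a(B)`: the number of zero entries on the diagonal `a` whose first nonzero entries to the
right and below are both `1`. -/
def diagCount {n : ℕ} (B : Matrix (Fin n) (Fin n) SignType) (a : ℤ) : ℕ :=
  (Finset.univ.filter fun p : Fin n × Fin n =>
    diagIdx p.1 p.2 = a ∧ B p.1 p.2 = 0 ∧ RightIsOne B p.1 p.2 ∧ BelowIsOne B p.1 p.2).card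

/-- `I'_a(B)`: the number of zero entries on the antidiagonal `a` whose first nonzero entries to
the right and above are both `1`. -/
def antiCount {n : ℕ} (B : Matrix (Fin n) (Fin n) SignType) (a : ℤ) : ℕ :=
  (Finset.univ.filter fun p : Fin n × Fin n =>
    antiIdx p.1 p.2 = a ∧ B p.1 p.2 = 0 ∧ RightIsOne B p.1 p.2 ∧ AboveIsOne B p.1 p.2).card

/-- The sum over alternating sign matrices. -/
noncomputable def asmSum {K : Type*} [Field K] {n : ℕ} (A : Matrix (Fin n) (Fin n) K) (l m : ℤ → K) : K :=
  ∑ B ∈ Finset.univ.filter (IsASM (n := n)),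
    (∏ a ∈ Finset.Icc (2 - (n : ℤ)) ((n : ℤ) - 2), (l a ^ diagCount B a * m a ^ antiCount B a)) *
      ∏ i, ∏ j, (A i j ^ (B i j : ℤ) *
        (l (diagIdx i j) + m (antiIdx i j)) ^ (if B i j = -1 then 1 else 0 : ℕ))

/-- Names of the indeterminates: the matrix entries, the `λ_a` and the `μ_a`. -/
abbrev Vars (n : ℕ) : Type := (Fin n × Fin n) ⊕ (ℤ ⊕ ℤ)

/-- The field of rational functions in all these indeterminates. -/
abbrev RatFun (K : Type*) [Field K] (n : ℕ) : Type _ := FractionRing (MvPolynomial (Vars n) K)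

/-- An indeterminate, as a rational function. -/
noncomputable def var (K : Type*) [Field K] (n : ℕ) (v : Vars n) : RatFun K n :=
  algebraMap (MvPolynomial (Vars n) K) (RatFun K n) (MvPolynomial.X v)

/-- The matrix of indeterminates. -/
noncomputable def genMatrix (K : Type*) [Field K] (n : ℕ) : Matrix (Fin n) (Fin n) (RatFun K n) :=
  fun i j => var K n (Sum.inl (i, j))

/-- The sequence of indeterminates `λ_a`. -/
noncomputable def genLambda (K : Type*) [Field K] (n : ℕ) : ℤ → RatFun K n :=
  fun a => var K n (Sum.inr (Sum.inl a))

/-- The sequence of indeterminates `μ_a`. -/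
noncomputable def genMu (K : Type*) [Field K] (n : ℕ) : ℤ → RatFun K n :=
  fun a => var K n (Sum.inr (Sum.inr a))

/-- The assignment of values to the indeterminates given by `A`, `l`, `m`. -/
def point {K : Type*} {n : ℕ} (A : Matrix (Fin n) (Fin n) K) (l m : ℤ → K) : Vars n → K :=
  Sum.elim (fun p => A p.1 p.2) (Sum.elim l m)

/-- The rational function `r` is regular at the point `x`, with value `v` there. -/
def HasValueAt {K : Type*} [Field K] {n : ℕ} (r : RatFun K n) (x : Vars n → K) (v : K) : Prop :=
  ∃ P Q : MvPolynomial (Vars n) K, MvPolynomial.eval x Q ≠ 0 ∧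
    r = algebraMap (MvPolynomial (Vars n) K) (RatFun K n) P /
      algebraMap (MvPolynomial (Vars n) K) (RatFun K n) Q ∧
    v = MvPolynomial.eval x P / MvPolynomial.eval x Q

end LambdaDet

/-!
Let `T_k` be the array of the generalized Lambda-determinants of the contiguous `k × k` blocks of
`A`, so that the recursion is a condensation identity between `T_{k+2}`, `T_{k+1}` and `T_k`.
Encode alternating sign matrices by their corner sums. When `k + N = n - 1`, consider the generating
function of the pairs of an alternating sign matrix `c` of size `N + 1` and an interlacing one `y`
of size `N`, in which the entries of `c` are exponents of `T_{k+1}`, those of `y` are exponents of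
`T_k⁻¹`, and the parameters `λ`, `μ` mark the position of `y` relative to `c`.

This sum does not depend on `N`. Indeed, for a fixed `c`, both the sum over the smaller arrays `y`
and the sum over the larger arrays `z` interlacing with `c` are products over the cells of `c`,
since the values of `y` and `z` at different cells can be chosen independently. The condensation
identity replaces `T_{k+2}` by `(u + v) / T_k`, where `u` and `v` are its two terms, and then the
local factors agree, cell by cell. At `N = 0` the sum is `|A|`. At `N = n - 1` we have `T_0 = 1`,
and summing over `y` yields the weights in the sum over alternating sign matrices.

This requires every block to have a nonzero determinant, which holds for indeterminates. The other
points are reached by specialization: an entry `-1` of an alternating sign matrix is never on the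
border, so the sum is regular where the interior entries of `A` do not vanish, and they do not
vanish where the recursion makes sense, because they are the denominators for the `3 × 3` blocks.
-/

namespace LambdaDet

open Finset

section CornerSums

/-- The mixed second difference of an array at the cell with upper left corner `(i, j)`. It recovers
a matrix from its corner sums. -/
def cell (c : ℕ → ℕ → ℤ) (i j : ℕ) : ℤ := c (i + 1) (j + 1) + c i j - c i (j + 1) - c (i + 1) j

/-- The boundary values shared by the corner sum arrays of all `N × N` alternating sign matrices. -/
structure HasBoundary (N : ℕ) (c : ℕ → ℕ → ℤ) : Prop where
  left : ∀ i ≤ N, c i 0 = 0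
  top : ∀ j ≤ N, c 0 j = 0
  bottom : ∀ j ≤ N, c N j = j
  right : ∀ i ≤ N, c i N = i

/-- Corner sum arrays of `N × N` alternating sign matrices: `c i j` is the sum of the entries in the
first `i` rows and the first `j` columns. -/
structure IsCornerSum (N : ℕ) (c : ℕ → ℕ → ℤ) : Prop extends HasBoundary N c where
  row : ∀ i ≤ N, ∀ j < N, c i j ≤ c i (j + 1) ∧ c i (j + 1) ≤ c i j + 1
  col : ∀ i < N, ∀ j ≤ N, c i j ≤ c (i + 1) j ∧ c (i + 1) j ≤ c i j + 1

variable {N : ℕ} {c : ℕ → ℕ → ℤ} {i j : ℕ}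

theorem IsCornerSum.swap (hc : IsCornerSum N c) : IsCornerSum N fun i j => c j i where
  left := hc.top
  top := hc.left
  bottom := hc.right
  right := hc.bottom
  row i hi j hj := hc.col j hj i hi
  col i hi j hj := hc.row j hj i hi

theorem IsCornerSum.nonneg (hc : IsCornerSum N c) (hi : i ≤ N) (hj : j ≤ N) : 0 ≤ c i j := by
  induction j with
  | zero => exact (hc.left i hi).ge
  | succ j ih => exact (ih (by omega)).trans (hc.row i hi j (by omega)).1

theorem IsCornerSum.le (hc : IsCornerSum N c) (hi : i ≤ N) (hj : j ≤ N) : c i j ≤ j := by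
  induction j with
  | zero => exact (hc.left i hi).le
  | succ j ih =>
    have := ih (by omega)
    have := (hc.row i hi j (by omega)).2
    push_cast
    omega

-- These are the six local configurations of the six-vertex model.
theorem IsCornerSum.cell_cases (hc : IsCornerSum N c) (hi : i < N) (hj : j < N) :
    (c i (j + 1) = c i j ∧ c (i + 1) j = c i j ∧ c (i + 1) (j + 1) = c i j ∧
      cell c i j = 0) ∨
    (c i (j + 1) = c i j ∧ c (i + 1) j = c i j ∧ c (i + 1) (j + 1) = c i j + 1 ∧
      cell c i j = 1) ∨
    (c i (j + 1) = c i j ∧ c (i + 1) j = c i j + 1 ∧ c (i + 1) (j + 1) = c i j + 1 ∧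
      cell c i j = 0) ∨
    (c i (j + 1) = c i j + 1 ∧ c (i + 1) j = c i j ∧ c (i + 1) (j + 1) = c i j + 1 ∧
      cell c i j = 0) ∨
    (c i (j + 1) = c i j + 1 ∧ c (i + 1) j = c i j + 1 ∧ c (i + 1) (j + 1) = c i j + 1 ∧
      cell c i j = -1) ∨
    (c i (j + 1) = c i j + 1 ∧ c (i + 1) j = c i j + 1 ∧ c (i + 1) (j + 1) = c i j + 1 + 1 ∧
      cell c i j = 0) := by
  unfold cell
  have := hc.row i hi.le j hj
  have := hc.row (i + 1) hi j hj
  have := hc.col i hi j hj.le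
  have := hc.col i hi (j + 1) hj
  omega

theorem IsCornerSum.interior_row_of_cell_eq_neg_one (hc : IsCornerSum N c) (hi : i < N) (hj : j < N)
    (h : cell c i j = -1) : 0 < i ∧ i + 1 < N := by
  have hcases := hc.cell_cases hi hj
  constructor <;> by_contra hcon
  · obtain rfl : i = 0 := by omega
    have := hc.top j hj.le
    have := hc.top (j + 1) hj
    omega
  · obtain rfl : N = i + 1 := by omega
    have := hc.bottom j hj.le
    have := hc.bottom (j + 1) hj
    omega

theorem finite_setOf_isCornerSum (N : ℕ) :
    {c : ℕ → ℕ → ℤ | IsCornerSum N c ∧ ∀ i j, N < i ∨ N < j → c i j = 0}.Finite := by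
  refine Set.Finite.of_injOn (f := fun c (p : Fin (N + 1) × Fin (N + 1)) => c p.1 p.2)
    (t := ↑(Fintype.piFinset fun _ : Fin (N + 1) × Fin (N + 1) => Icc (0 : ℤ) N)) ?_ ?_
    (Finset.finite_toSet _)
  · rintro c ⟨hc, -⟩
    simp only [mem_coe, Fintype.mem_piFinset, mem_Icc, Prod.forall]
    intro i j
    have := hc.le (i := i) (j := j) (by omega) (by omega)
    exact ⟨hc.nonneg (by omega) (by omega), by omega⟩
  · rintro c ⟨-, hc⟩ d ⟨-, hd⟩ h
    funext i j
    by_cases hij : N < i ∨ N < j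
    · rw [hc i j hij, hd i j hij]
    · exact congrFun h (⟨i, by omega⟩, ⟨j, by omega⟩)

/-- The finite set of corner sum arrays of `N × N` alternating sign matrices. An array is made to
vanish outside its `(N + 1) × (N + 1)` square, so that it is determined by its values there. -/
noncomputable def cornerSums (N : ℕ) : Finset (ℕ → ℕ → ℤ) := (finite_setOf_isCornerSum N).toFinset

theorem mem_cornerSums :
    c ∈ cornerSums N ↔ IsCornerSum N c ∧ ∀ i j, N < i ∨ N < j → c i j = 0 := by
  simp [cornerSums]

theorem isCornerSum_of_mem_cornerSums (hc : c ∈ cornerSums N) : IsCornerSum N c :=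
  (mem_cornerSums.1 hc).1

theorem cornerSums_ext {c d : ℕ → ℕ → ℤ} (hc : c ∈ cornerSums N) (hd : d ∈ cornerSums N)
    (h : ∀ i j, 0 < i → i < N → 0 < j → j < N → c i j = d i j) : c = d := by
  obtain ⟨hc, hc0⟩ := mem_cornerSums.1 hc
  obtain ⟨hd, hd0⟩ := mem_cornerSums.1 hd
  funext i j
  by_cases hij : N < i ∨ N < j
  · rw [hc0 i j hij, hd0 i j hij]
  push Not at hij
  rcases Nat.eq_zero_or_pos i with rfl | hi
  · rw [hc.top j hij.2, hd.top j hij.2]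
  rcases Nat.eq_zero_or_pos j with rfl | hj
  · rw [hc.left i hij.1, hd.left i hij.1]
  rcases hij.1.eq_or_lt with rfl | hi'
  · rw [hc.bottom j hij.2, hd.bottom j hij.2]
  rcases hij.2.eq_or_lt with rfl | hj'
  · rw [hc.right i hij.1, hd.right i hij.1]
  exact h i j hi hi' hj hj'

/-- The corner sums of the identity matrix, extended by zero. They serve as a reference point in
`cornerSums N`. -/
def diagCornerSum (N i j : ℕ) : ℤ := if N < i ∨ N < j then 0 else min i j

theorem diagCornerSum_mem_cornerSums (N : ℕ) : diagCornerSum N ∈ cornerSums N := by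
  refine mem_cornerSums.2 ⟨⟨⟨?_, ?_, ?_, ?_⟩, ?_, ?_⟩, ?_⟩ <;> unfold diagCornerSum <;> grind

theorem cornerSums_eq_singleton (hN : N ≤ 1) : cornerSums N = {diagCornerSum N} :=
  eq_singleton_iff_unique_mem.2 ⟨diagCornerSum_mem_cornerSums N, fun _ hc =>
    cornerSums_ext hc (diagCornerSum_mem_cornerSums N) (by omega)⟩

end CornerSums

section Interlacing

/-- Interlacing of an array `y`, placed on the cells of the `N × N` array `c`, with `c`. -/
def Interlace (N : ℕ) (c y : ℕ → ℕ → ℤ) : Prop :=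
  ∀ i < N, ∀ j < N, c i j ≤ y i j ∧ c (i + 1) (j + 1) ≤ y i j + 1 ∧
    y i j ≤ c i (j + 1) ∧ y i j ≤ c (i + 1) j

instance (N : ℕ) (c y : ℕ → ℕ → ℤ) : Decidable (Interlace N c y) := by
  unfold Interlace; infer_instance

variable {N : ℕ} {c y z : ℕ → ℕ → ℤ}

theorem Interlace.isCornerSum_inner (hc : HasBoundary (N + 1) c) (h : Interlace (N + 1) c y) :
    IsCornerSum N y where
  left i hi := by
    have := h i (by omega) 0 (by omega)
    have := hc.left i (by omega)
    have := hc.left (i + 1) (by omega)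
    omega
  top j hj := by
    have := h 0 (by omega) j (by omega)
    have := hc.top j (by omega)
    have := hc.top (j + 1) (by omega)
    omega
  bottom j hj := by
    have := h N (by omega) j (by omega)
    have := hc.bottom j (by omega)
    have := hc.bottom (j + 1) (by omega)
    omega
  right i hi := by
    have := h i (by omega) N (by omega)
    have := hc.right i (by omega)
    have := hc.right (i + 1) (by omega)
    omega
  row i hi j hj := by
    have := h i (by omega) j (by omega)
    have := h i (by omega) (j + 1) (by omega)
    omega
  col i hi j hj := by
    have := h i (by omega) j (by omega)
    have := h (i + 1) (by omega) j (by omega)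
    omega

theorem Interlace.isCornerSum_outer (hz : HasBoundary N z) (h : Interlace N z c) :
    IsCornerSum N z where
  toHasBoundary := hz
  row i hi j hj := by
    constructor
    · rcases hi.lt_or_eq with hi | rfl
      · exact (h i hi j hj).1.trans (h i hi j hj).2.2.1
      · rw [hz.bottom j (by omega), hz.bottom (j + 1) (by omega)]
        omega
    · rcases i with _ | i
      · rw [hz.top j (by omega), hz.top (j + 1) (by omega)]
        omega
      · have := h i (by omega) j hj
        omega
  col i hi j hj := by
    constructor
    · rcases hj.lt_or_eq with hj | rfl
      · exact (h i hi j hj).1.trans (h i hi j hj).2.2.2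
      · rw [hz.right i (by omega), hz.right (i + 1) (by omega)]
        omega
    · rcases j with _ | j
      · rw [hz.left i (by omega), hz.left (i + 1) (by omega)]
        omega
      · have := h i hi j (by omega)
        omega

/-- The values allowed at the cell `(i, j)` for a smaller array interlacing with `c`. -/
noncomputable def innerRange (c : ℕ → ℕ → ℤ) (i j : ℕ) : Finset ℤ :=
  Icc (max (c i j) (c (i + 1) (j + 1) - 1)) (min (c i (j + 1)) (c (i + 1) j))

/-- The values allowed at the cell `(i, j)` for a larger array interlacing with `c`. -/
noncomputable def outerRange (c : ℕ → ℕ → ℤ) (i j : ℕ) : Finset ℤ :=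
  Icc (max (c i (j + 1)) (c (i + 1) j)) (min (c i j + 1) (c (i + 1) (j + 1)))

theorem interlace_iff_mem_innerRange :
    Interlace N c y ↔ ∀ i < N, ∀ j < N, y i j ∈ innerRange c i j := by
  simp only [Interlace, innerRange, mem_Icc, max_le_iff, le_min_iff, sub_le_iff_le_add, and_assoc]

theorem interlace_iff_mem_outerRange (hz : HasBoundary (N + 2) z) (hc : HasBoundary (N + 1) c) :
    Interlace (N + 2) z c ↔
      ∀ i < N + 1, ∀ j < N + 1, z (i + 1) (j + 1) ∈ outerRange c i j := by
  simp only [outerRange, mem_Icc, max_le_iff, le_min_iff]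
  constructor <;> intro h i hi j hj
  · have := h i (by omega) j (by omega)
    have := h (i + 1) (by omega) (j + 1) (by omega)
    have := h i (by omega) (j + 1) (by omega)
    have := h (i + 1) (by omega) j (by omega)
    omega
  · refine ⟨?_, ?_, ?_, ?_⟩
    · rcases i with _ | i
      · rw [hz.top j (by omega), hc.top j (by omega)]
      rcases j with _ | j
      · rw [hz.left _ (by omega), hc.left _ (by omega)]
      exact (h i (by omega) j (by omega)).2.2
    · rcases (by omega : i = N + 1 ∨ i < N + 1) with rfl | hi'
      · simp [hz.bottom (j + 1) (by omega), hc.bottom j (by omega)]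
      rcases (by omega : j = N + 1 ∨ j < N + 1) with rfl | hj'
      · simp [hz.right (i + 1) (by omega), hc.right i (by omega)]
      exact (h i hi' j hj').2.1
    · rcases i with _ | i
      · rw [hz.top _ (by omega), hc.top j (by omega)]
      rcases (by omega : j = N + 1 ∨ j < N + 1) with rfl | hj'
      · rw [hz.right _ (by omega), hc.right _ (by omega)]
      exact (h i (by omega) j hj').1.2
    · rcases j with _ | j
      · rw [hz.left _ (by omega), hc.left _ (by omega)]
      rcases (by omega : i = N + 1 ∨ i < N + 1) with rfl | hi'
      · rw [hz.bottom _ (by omega), hc.bottom _ (by omega)]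
      exact (h i hi' j (by omega)).1.1

theorem prod_sum_eq_sum_prod_of_bijOn {κ R : Type*} [CommSemiring R] (M : ℕ) (U : Finset κ)
    (φ : κ → ℕ → ℕ → ℤ) (S : ℕ → ℕ → Finset ℤ) (f : ℕ → ℕ → ℤ → R)
    (hmem : ∀ u ∈ U, ∀ i < M, ∀ j < M, φ u i j ∈ S i j)
    (hinj : ∀ u ∈ U, ∀ v ∈ U, (∀ i < M, ∀ j < M, φ u i j = φ v i j) → u = v)
    (hsurj : ∀ g : ℕ → ℕ → ℤ, (∀ i < M, ∀ j < M, g i j ∈ S i j) →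
      ∃ u ∈ U, ∀ i < M, ∀ j < M, φ u i j = g i j) :
    ∏ i ∈ range M, ∏ j ∈ range M, ∑ t ∈ S i j, f i j t =
      ∑ u ∈ U, ∏ i ∈ range M, ∏ j ∈ range M, f i j (φ u i j) := by
  have prod_range_range (g : ℕ → ℕ → R) : ∏ i ∈ range M, ∏ j ∈ range M, g i j =
      ∏ p : Fin M × Fin M, g p.1 p.2 := by
    simp only [Fintype.prod_prod_type, prod_range]
  simp only [prod_range_range, prod_univ_sum]
  refine (sum_bij (fun u _ p => φ u p.1 p.2) (fun u hu => ?_) (fun u hu v hv h => ?_)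
    (fun g hg => ?_) fun u _ => rfl).symm
  · exact Fintype.mem_piFinset.2 fun p => hmem u hu _ p.1.2 _ p.2.2
  · exact hinj u hu v hv fun i hi j hj => congrFun h (⟨i, hi⟩, ⟨j, hj⟩)
  · obtain ⟨u, hu, h⟩ := hsurj
      (fun i j => if h : i < M ∧ j < M then g (⟨i, h.1⟩, ⟨j, h.2⟩) else 0) fun i hi j hj => by
        simpa only [hi, hj, and_self, dite_true] using
          Fintype.mem_piFinset.1 hg (⟨i, hi⟩, ⟨j, hj⟩)
    refine ⟨u, hu, funext fun p => ?_⟩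
    rw [h _ p.1.2 _ p.2.2, dif_pos ⟨p.1.2, p.2.2⟩]

variable {R : Type*} [CommSemiring R]

theorem prod_sum_innerRange (hc : HasBoundary (N + 1) c) (f : ℕ → ℕ → ℤ → R) :
    ∏ i ∈ range (N + 1), ∏ j ∈ range (N + 1), ∑ t ∈ innerRange c i j, f i j t =
      ∑ y ∈ cornerSums N with Interlace (N + 1) c y,
        ∏ i ∈ range (N + 1), ∏ j ∈ range (N + 1), f i j (y i j) := by
  refine prod_sum_eq_sum_prod_of_bijOn (N + 1) _ (fun y => y) _ f (fun y hy => ?_)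
    (fun y hy y' hy' h => ?_) fun g hg => ?_
  · exact interlace_iff_mem_innerRange.1 (mem_filter.1 hy).2
  · exact cornerSums_ext (mem_filter.1 hy).1 (mem_filter.1 hy').1 fun i j _ hi _ hj =>
      h i (by omega) j (by omega)
  · let y : ℕ → ℕ → ℤ := fun i j => if N < i ∨ N < j then 0 else g i j
    have hy (i) (hi : i < N + 1) (j) (hj : j < N + 1) : y i j = g i j := if_neg (by omega)
    have hcy : Interlace (N + 1) c y := interlace_iff_mem_innerRange.2 fun i hi j hj => by
      rw [hy i hi j hj]
      exact hg i hi j hj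
    exact ⟨y, mem_filter.2 ⟨mem_cornerSums.2 ⟨hcy.isCornerSum_inner hc, fun _ _ h => if_pos h⟩,
      hcy⟩, hy⟩

/-- The array `g`, moved to the interior of a square of side `N + 1` and surrounded by the boundary
values of the corner sum arrays in `cornerSums (N + 1)`. -/
def addBoundary (N : ℕ) (g : ℕ → ℕ → ℤ) (i j : ℕ) : ℤ :=
  if N + 1 < i ∨ N + 1 < j then 0 else if i = N + 1 then j else if j = N + 1 then i else
    if i = 0 ∨ j = 0 then 0 else g (i - 1) (j - 1)

theorem hasBoundary_addBoundary (N : ℕ) (g : ℕ → ℕ → ℤ) :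
    HasBoundary (N + 1) (addBoundary N g) := by
  constructor <;> intro i hi <;> unfold addBoundary <;> split_ifs <;> first | omega | simp_all

theorem addBoundary_succ_succ {g : ℕ → ℕ → ℤ} {i j : ℕ} (hi : i < N) (hj : j < N) :
    addBoundary N g (i + 1) (j + 1) = g i j := by
  simp [addBoundary, hi.ne, hj.ne, hi.not_gt, hj.not_gt]

theorem prod_sum_outerRange (hc : HasBoundary (N + 1) c) (f : ℕ → ℕ → ℤ → R) :
    ∏ i ∈ range (N + 1), ∏ j ∈ range (N + 1), ∑ t ∈ outerRange c i j, f i j t =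
      ∑ z ∈ cornerSums (N + 2) with Interlace (N + 2) z c,
        ∏ i ∈ range (N + 1), ∏ j ∈ range (N + 1), f i j (z (i + 1) (j + 1)) := by
  refine prod_sum_eq_sum_prod_of_bijOn (N + 1) _ (fun (z : ℕ → ℕ → ℤ) i j => z (i + 1) (j + 1))
    (outerRange c) f (fun z hz => ?_) (fun z hz z' hz' h => ?_) fun g hg => ?_
  · have hz := mem_filter.1 hz
    exact (interlace_iff_mem_outerRange (isCornerSum_of_mem_cornerSums hz.1).toHasBoundary hc).1
      hz.2
  · refine cornerSums_ext (mem_filter.1 hz).1 (mem_filter.1 hz').1 fun i j hi hi' hj hj' => ?_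
    obtain ⟨i, rfl⟩ := Nat.exists_eq_add_of_lt hi
    obtain ⟨j, rfl⟩ := Nat.exists_eq_add_of_lt hj
    simpa using h i (by omega) j (by omega)
  · have hB := hasBoundary_addBoundary (N + 1) g
    have hBc : Interlace (N + 2) (addBoundary (N + 1) g) c :=
      (interlace_iff_mem_outerRange hB hc).2 fun i hi j hj => by
        rw [addBoundary_succ_succ hi hj]
        exact hg i hi j hj
    exact ⟨_, mem_filter.2 ⟨mem_cornerSums.2 ⟨hBc.isCornerSum_outer hB, fun _ _ h => if_pos h⟩,
      hBc⟩, fun i hi j hj => addBoundary_succ_succ hi hj⟩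

end Interlacing

section SummationByParts

theorem prod_range_window {G : Type*} [CommMonoid G] {M M' p : ℕ} (h : M + p ≤ M')
    (f : ℕ → ℕ → G) :
    ∏ i ∈ range M, f (i + p) i =
      ∏ i ∈ range M', if p ≤ i ∧ i < M + p then f i (i - p) else 1 := by
  rw [← prod_filter]
  refine prod_nbij' (· + p) (· - p) ?_ ?_ ?_ ?_ ?_ <;> simp <;> omega

variable {G : Type*} [CommGroupWithZero G]

theorem prod_zpow_window {M M' p q : ℕ} (hp : M + p ≤ M') (hq : M + q ≤ M') (t : ℕ → ℕ → G)
    (e : ℕ → ℕ → ℤ) :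
    ∏ i ∈ range M, ∏ j ∈ range M, t (i + p) (j + q) ^ e i j =
      ∏ i ∈ range M', ∏ j ∈ range M', t i j ^
        (if (p ≤ i ∧ i < M + p) ∧ q ≤ j ∧ j < M + q then e (i - p) (j - q) else 0) := by
  rw [prod_range_window hp fun i k => ∏ j ∈ range M, t i (j + q) ^ e k j]
  refine prod_congr rfl fun i _ => ?_
  split_ifs with hi
  · rw [prod_range_window hq fun j k => t i j ^ e (i - p) k]
    refine prod_congr rfl fun j _ => ?_
    split_ifs <;> simp_all
  · simp [hi]

theorem prod_zpow_cell_mul_prod_zpow_cell {N : ℕ} {t : ℕ → ℕ → G} (ht : ∀ i j, t i j ≠ 0)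
    {z c y : ℕ → ℕ → ℤ} (hz : HasBoundary (N + 2) z) (hc : HasBoundary (N + 1) c)
    (hy : HasBoundary N y) :
    (∏ i ∈ range (N + 2), ∏ j ∈ range (N + 2), t i j ^ cell z i j) *
        ∏ i ∈ range N, ∏ j ∈ range N, t (i + 1) (j + 1) ^ cell y i j =
      ∏ i ∈ range (N + 1), ∏ j ∈ range (N + 1),
        ((t i j * t (i + 1) (j + 1)) ^ (z (i + 1) (j + 1) + y i j - c i (j + 1) - c (i + 1) j) *
          (t i (j + 1) * t (i + 1) j) ^
            (c i j + c (i + 1) (j + 1) - z (i + 1) (j + 1) - y i j)) := by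
  have window {p q : ℕ} (hp : p ≤ 1) (hq : q ≤ 1) :=
    prod_zpow_window (M := N + 1) (M' := N + 2) (by omega : _ + p ≤ _) (by omega : _ + q ≤ _) t
  have window_nw := window zero_le_one zero_le_one
  have window_ne := window zero_le_one le_rfl
  have window_sw := window le_rfl zero_le_one
  have window_se := window le_rfl le_rfl
  simp only [add_zero] at window_nw window_ne window_sw
  simp only [mul_zpow, prod_mul_distrib]
  rw [prod_zpow_window (M' := N + 2) (by omega) (by omega) t (cell y), window_nw, window_se,
    window_ne, window_sw]
  simp only [← prod_mul_distrib, ← zpow_add₀ (ht _ _)]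
  refine prod_congr rfl fun i hi => prod_congr rfl fun j hj => ?_
  rw [mem_range] at hi hj
  congr 1
  obtain ⟨_, _, _, _⟩ := hz
  obtain ⟨_, _, _, _⟩ := hc
  obtain ⟨_, _, _, _⟩ := hy
  have side (k : ℕ) (hk : k < N + 2) : k = 0 ∨ (∃ k', k = k' + 1 ∧ k' < N) ∨ k = N + 1 := by
    rcases k with _ | k
    · simp
    · rcases (by omega : k < N ∨ k = N) with h | h <;> simp [h]
  unfold cell
  rcases side i hi with rfl | ⟨i, rfl, hi⟩ | rfl <;>
    rcases side j hj with rfl | ⟨j, rfl, hj⟩ | rfl <;> grind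

end SummationByParts

section Weights

variable {L : Type*} [Field L]

/-- The weight `u ^ (c i (j + 1) - x) * v ^ (x + 1 - c (i + 1) (j + 1))` of the value `x` at the
cell `(i, j)` of a smaller array interlacing with `c`. The exponents are `0` or `1`. -/
def innerWeight (u v : L) (c : ℕ → ℕ → ℤ) (i j : ℕ) (x : ℤ) : L :=
  u ^ (c i (j + 1) - x) * v ^ (x + 1 - c (i + 1) (j + 1))

/-- The weight `u ^ (x - c (i + 1) j) * v ^ (c i j + 1 - x)` of the value `x` at the cell `(i, j)`
of a larger array interlacing with `c`. The exponents are `0` or `1`. -/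
def outerWeight (u v : L) (c : ℕ → ℕ → ℤ) (i j : ℕ) (x : ℤ) : L :=
  u ^ (x - c (i + 1) j) * v ^ (c i j + 1 - x)

/-- The factor that the cell `(i, j)` of a corner sum array contributes to the sum over alternating
sign matrices, apart from the matrix entry. -/
def cellWeight (l m : L) (c : ℕ → ℕ → ℤ) (i j : ℕ) : L :=
  (if cell c i j = 0 ∧ c (i + 1) (j + 1) = c i (j + 1) ∧ c (i + 1) (j + 1) = c (i + 1) j
    then l else 1) *
  (if cell c i j = 0 ∧ c (i + 1) (j + 1) = c i (j + 1) ∧ c i (j + 1) = c i j + 1 then m else 1) *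
  (if cell c i j = -1 then l + m else 1)

variable {N : ℕ} {c : ℕ → ℕ → ℤ} {i j : ℕ} {u u' v v' : L}

theorem innerWeight_mul (x : ℤ) :
    innerWeight (u * u') (v * v') c i j x =
      innerWeight u v c i j x * innerWeight u' v' c i j x := by
  simp only [innerWeight, mul_zpow]
  ring

theorem outerWeight_mul (x : ℤ) :
    outerWeight (u * u') (v * v') c i j x =
      outerWeight u v c i j x * outerWeight u' v' c i j x := by
  simp only [outerWeight, mul_zpow]
  ring

theorem IsCornerSum.sum_innerWeight (hc : IsCornerSum N c) (hi : i < N) (hj : j < N) (l m : L) :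
    ∑ x ∈ innerRange c i j, innerWeight m l c i j x = cellWeight l m c i j := by
  unfold innerRange innerWeight cellWeight
  rcases hc.cell_cases hi hj with ⟨h₁, h₂, h₃, h⟩ | ⟨h₁, h₂, h₃, h⟩ | ⟨h₁, h₂, h₃, h⟩ |
    ⟨h₁, h₂, h₃, h⟩ | ⟨h₁, h₂, h₃, h⟩ | ⟨h₁, h₂, h₃, h⟩ <;>
  simp [h₁, h₂, h₃, h, Int.Icc_eq_pair, add_comm l]

theorem IsCornerSum.zpow_cell_mul_sum_innerWeight (hc : IsCornerSum N c) (hi : i < N) (hj : j < N)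
    (huv : u + v ≠ 0) :
    (u + v) ^ cell c i j * ∑ x ∈ innerRange c i j, innerWeight u v c i j x =
      ∑ x ∈ outerRange c i j, outerWeight u v c i j x := by
  unfold innerRange outerRange innerWeight outerWeight
  rcases hc.cell_cases hi hj with ⟨h₁, h₂, h₃, h⟩ | ⟨h₁, h₂, h₃, h⟩ | ⟨h₁, h₂, h₃, h⟩ |
    ⟨h₁, h₂, h₃, h⟩ | ⟨h₁, h₂, h₃, h⟩ | ⟨h₁, h₂, h₃, h⟩ <;>
  simp [h₁, h₂, h₃, h, Int.Icc_eq_pair, add_comm v, huv]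

end Weights

section PairSums

variable {L : Type*} [Field L] {N : ℕ} {a b d l m : ℕ → ℕ → L} {c z : ℕ → ℕ → ℤ}

/-- The product of the two diagonally opposite entries `(i, j)` and `(i + 1, j + 1)` of an array. -/
def diagProd (t : ℕ → ℕ → L) (i j : ℕ) : L := t i j * t (i + 1) (j + 1)

/-- The product of the two antidiagonally opposite entries `(i, j + 1)` and `(i + 1, j)` of an
array. -/
def antidiagProd (t : ℕ → ℕ → L) (i j : ℕ) : L := t i (j + 1) * t (i + 1) j

theorem prod_zpow_cell_mul_prod_innerWeight {t : ℕ → ℕ → L} (ht : ∀ i j, t i j ≠ 0)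
    {y : ℕ → ℕ → ℤ} (hz : HasBoundary (N + 2) z) (hc : HasBoundary (N + 1) c)
    (hy : HasBoundary N y) :
    (∏ i ∈ range (N + 2), ∏ j ∈ range (N + 2), t i j ^ cell z i j) *
        (∏ i ∈ range N, ∏ j ∈ range N, t (i + 1) (j + 1) ^ cell y i j) *
        ∏ i ∈ range (N + 1), ∏ j ∈ range (N + 1),
          innerWeight (diagProd t i j) (antidiagProd t i j) c i j (y i j) =
      ∏ i ∈ range (N + 1), ∏ j ∈ range (N + 1),
        outerWeight (diagProd t i j) (antidiagProd t i j) c i j (z (i + 1) (j + 1)) := by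
  rw [prod_zpow_cell_mul_prod_zpow_cell ht hz hc hy]
  simp only [← prod_mul_distrib]
  refine prod_congr rfl fun i _ => prod_congr rfl fun j _ => ?_
  have hdiag : diagProd t i j ≠ 0 := mul_ne_zero (ht _ _) (ht _ _)
  have hanti : antidiagProd t i j ≠ 0 := mul_ne_zero (ht _ _) (ht _ _)
  rw [← diagProd, ← antidiagProd, innerWeight, outerWeight, mul_mul_mul_comm, ← zpow_add₀ hdiag,
    ← zpow_add₀ hanti]
  congr 2 <;> ring

theorem exists_prod_zpow_cell_eq {t : ℕ → ℕ → L} (ht : ∀ i j, t i j ≠ 0)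
    (hc : HasBoundary (N + 1) c) :
    ∃ k : L,
      (∀ y, HasBoundary N y → ∏ i ∈ range N, ∏ j ∈ range N, t (i + 1) (j + 1) ^ (-cell y i j) =
        k * ∏ i ∈ range (N + 1), ∏ j ∈ range (N + 1),
          innerWeight (diagProd t i j) (antidiagProd t i j) c i j (y i j)) ∧
      ∀ z, HasBoundary (N + 2) z → ∏ i ∈ range (N + 2), ∏ j ∈ range (N + 2), t i j ^ cell z i j =
        k * ∏ i ∈ range (N + 1), ∏ j ∈ range (N + 1),
          outerWeight (diagProd t i j) (antidiagProd t i j) c i j (z (i + 1) (j + 1)) := by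
  let Y (y : ℕ → ℕ → ℤ) : L := ∏ i ∈ range N, ∏ j ∈ range N, t (i + 1) (j + 1) ^ cell y i j
  let Z (z : ℕ → ℕ → ℤ) : L := ∏ i ∈ range (N + 2), ∏ j ∈ range (N + 2), t i j ^ cell z i j
  let inner (y : ℕ → ℕ → ℤ) : L := ∏ i ∈ range (N + 1), ∏ j ∈ range (N + 1),
    innerWeight (diagProd t i j) (antidiagProd t i j) c i j (y i j)
  let outer (z : ℕ → ℕ → ℤ) : L := ∏ i ∈ range (N + 1), ∏ j ∈ range (N + 1),
    outerWeight (diagProd t i j) (antidiagProd t i j) c i j (z (i + 1) (j + 1))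
  have key {z y : ℕ → ℕ → ℤ} (hz : HasBoundary (N + 2) z) (hy : HasBoundary N y) :
      Z z * Y y * inner y = outer z := prod_zpow_cell_mul_prod_innerWeight ht hz hc hy
  have prod_ne_zero {M : ℕ} {f : ℕ → ℕ → L} (hf : ∀ i j, f i j ≠ 0) :
      ∏ i ∈ range M, ∏ j ∈ range M, f i j ≠ 0 :=
    prod_ne_zero_iff.2 fun i _ => prod_ne_zero_iff.2 fun j _ => hf i j
  have hY (y) : Y y ≠ 0 := prod_ne_zero fun i j => zpow_ne_zero _ (ht _ _)
  have houter (z) : outer z ≠ 0 := prod_ne_zero fun i j =>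
    mul_ne_zero (zpow_ne_zero _ (mul_ne_zero (ht _ _) (ht _ _)))
      (zpow_ne_zero _ (mul_ne_zero (ht _ _) (ht _ _)))
  have hdiag (M : ℕ) : HasBoundary M (diagCornerSum M) :=
    (isCornerSum_of_mem_cornerSums (diagCornerSum_mem_cornerSums M)).toHasBoundary
  refine ⟨Z (diagCornerSum (N + 2)) / outer (diagCornerSum (N + 2)), fun y hy => ?_, fun z hz => ?_⟩
  · simp only [zpow_neg, prod_inv_distrib]
    change (Y y)⁻¹ = _ * inner y
    rw [div_mul_eq_mul_div, eq_div_iff (houter _), ← key (hdiag _) hy]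
    field_simp [hY y]
  · change Z z = _ * outer z
    rw [div_mul_eq_mul_div, eq_div_iff (houter _), ← key hz (hdiag N), ← key (hdiag _) (hdiag N)]
    ring

theorem prod_innerWeight_eq_prod_outerWeight (hz : HasBoundary (N + 2) z)
    (hc : HasBoundary (N + 1) c) :
    ∏ i ∈ range (N + 2), ∏ j ∈ range (N + 2), innerWeight (m i j) (l i j) z i j (c i j) =
      ∏ i ∈ range (N + 1), ∏ j ∈ range (N + 1),
        outerWeight (m (i + 1) j) (l i j) c i j (z (i + 1) (j + 1)) := by
  have window_nw := prod_zpow_window (M := N + 1) (M' := N + 2) (p := 0) (q := 0) (by omega)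
    (by omega) l
  have window_sw := prod_zpow_window (M := N + 1) (M' := N + 2) (p := 1) (q := 0) (by omega)
    (by omega) m
  simp only [add_zero] at window_nw window_sw
  simp only [innerWeight, outerWeight, prod_mul_distrib]
  rw [window_nw, window_sw]
  simp only [← prod_mul_distrib]
  refine prod_congr rfl fun i hi => prod_congr rfl fun j hj => ?_
  rw [mem_range] at hi hj
  obtain ⟨_, _, _, _⟩ := hz
  obtain ⟨_, _, _, _⟩ := hc
  congr 2
  · rcases i with _ | i <;> grind
  · grind

theorem sum_inner_eq_sum_outer (hb : ∀ i j, b i j ≠ 0)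
    (hsum : ∀ i j, m i j * diagProd b i j + l i j * antidiagProd b i j ≠ 0)
    (hc : IsCornerSum (N + 1) c) :
    ∑ y ∈ cornerSums N with Interlace (N + 1) c y,
      (∏ i ∈ range (N + 1), ∏ j ∈ range (N + 1),
        (m i j * diagProd b i j + l i j * antidiagProd b i j) ^ cell c i j *
          innerWeight (m i j) (l i j) c i j (y i j)) *
      ∏ i ∈ range N, ∏ j ∈ range N, b (i + 1) (j + 1) ^ (-cell y i j) =
    ∑ z ∈ cornerSums (N + 2) with Interlace (N + 2) z c,
      (∏ i ∈ range (N + 1), ∏ j ∈ range (N + 1),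
        outerWeight (m i j) (l i j) c i j (z (i + 1) (j + 1))) *
      ∏ i ∈ range (N + 2), ∏ j ∈ range (N + 2), b i j ^ cell z i j := by
  obtain ⟨k, hinner, houter⟩ := exists_prod_zpow_cell_eq hb hc.toHasBoundary
  have hboundary {M : ℕ} {y : ℕ → ℕ → ℤ} {p : (ℕ → ℕ → ℤ) → Prop} [DecidablePred p]
      (hy : y ∈ (cornerSums M).filter p) : HasBoundary M y :=
    (isCornerSum_of_mem_cornerSums (mem_filter.1 hy).1).toHasBoundary
  calc
    _ = k * ∑ y ∈ cornerSums N with Interlace (N + 1) c y,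
          ∏ i ∈ range (N + 1), ∏ j ∈ range (N + 1),
            (m i j * diagProd b i j + l i j * antidiagProd b i j) ^ cell c i j *
              innerWeight (m i j * diagProd b i j) (l i j * antidiagProd b i j) c i j (y i j) := by
      rw [mul_sum]
      refine sum_congr rfl fun y hy => ?_
      rw [hinner y (hboundary hy)]
      simp only [innerWeight_mul, prod_mul_distrib]
      ring
    _ = k * ∏ i ∈ range (N + 1), ∏ j ∈ range (N + 1), ∑ x ∈ outerRange c i j,
          outerWeight (m i j * diagProd b i j) (l i j * antidiagProd b i j) c i j x := by
      rw [← prod_sum_innerRange hc.toHasBoundary fun i j x =>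
        (m i j * diagProd b i j + l i j * antidiagProd b i j) ^ cell c i j *
          innerWeight (m i j * diagProd b i j) (l i j * antidiagProd b i j) c i j x]
      congr 1
      refine prod_congr rfl fun i hi => prod_congr rfl fun j hj => ?_
      rw [← mul_sum, hc.zpow_cell_mul_sum_innerWeight (mem_range.1 hi) (mem_range.1 hj) (hsum i j)]
    _ = _ := by
      rw [prod_sum_outerRange hc.toHasBoundary, mul_sum]
      refine sum_congr rfl fun z hz => ?_
      rw [houter z (hboundary hz)]
      simp only [outerWeight_mul, prod_mul_distrib]
      ring

/-- The generating function of the pairs consisting of a corner sum array `c` and a smaller one `y`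
that interlaces with it: `a` and `b` carry the exponents given by the cells of `c` and `y`, while
`l` and `m` mark the position of `y` relative to `c`. -/
noncomputable def pairSum (N : ℕ) (a b l m : ℕ → ℕ → L) : L :=
  ∑ c ∈ cornerSums (N + 1), ∑ y ∈ cornerSums N with Interlace (N + 1) c y,
    (∏ i ∈ range (N + 1), ∏ j ∈ range (N + 1),
      a i j ^ cell c i j * innerWeight (m i j) (l i j) c i j (y i j)) *
    ∏ i ∈ range N, ∏ j ∈ range N, b (i + 1) (j + 1) ^ (-cell y i j)

theorem pairSum_zero (a b l m : ℕ → ℕ → L) : pairSum 0 a b l m = a 0 0 := by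
  have hI : Interlace (0 + 1) (diagCornerSum 1) (diagCornerSum 0) := by
    simp [Interlace, diagCornerSum]
  rw [pairSum, cornerSums_eq_singleton zero_le_one, cornerSums_eq_singleton le_rfl, sum_singleton,
    filter_singleton, if_pos hI]
  simp [cell, innerWeight, diagCornerSum]

theorem pairSum_succ (ha : ∀ i j, a i j ≠ 0) (hb : ∀ i j, b i j ≠ 0) (hd : ∀ i j, d i j ≠ 0)
    (h : ∀ i j, a i j * d (i + 1) (j + 1) =
      m (i + 1) j * diagProd b i j + l i j * antidiagProd b i j) :
    pairSum (N + 1) b d l m = pairSum N a b l fun i j => m (i + 1) j := by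
  symm
  let term (c z : ℕ → ℕ → ℤ) : L :=
    (∏ i ∈ range (N + 1), ∏ j ∈ range (N + 1), d (i + 1) (j + 1) ^ (-cell c i j)) *
      ((∏ i ∈ range (N + 1), ∏ j ∈ range (N + 1),
        outerWeight (m (i + 1) j) (l i j) c i j (z (i + 1) (j + 1))) *
      ∏ i ∈ range (N + 2), ∏ j ∈ range (N + 2), b i j ^ cell z i j)
  calc
    _ = ∑ c ∈ cornerSums (N + 1), ∑ z ∈ cornerSums (N + 2) with Interlace (N + 2) z c,
        term c z := by
      refine sum_congr rfl fun c hc => ?_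
      rw [← mul_sum, ← sum_inner_eq_sum_outer hb
        (fun i j => h i j ▸ mul_ne_zero (ha i j) (hd _ _)) (isCornerSum_of_mem_cornerSums hc),
        mul_sum]
      refine sum_congr rfl fun y _ => ?_
      rw [← mul_assoc]
      congr 1
      simp only [← prod_mul_distrib]
      refine prod_congr rfl fun i _ => prod_congr rfl fun j _ => ?_
      rw [← h, mul_zpow, zpow_neg]
      field_simp [zpow_ne_zero (cell c i j) (hd (i + 1) (j + 1))]
    _ = ∑ z ∈ cornerSums (N + 2), ∑ c ∈ cornerSums (N + 1) with Interlace (N + 2) z c,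
        term c z :=
      sum_comm' fun c z => by simp only [mem_filter]; tauto
    _ = _ := by
      refine sum_congr rfl fun z hz => sum_congr rfl fun c hc => ?_
      rw [mem_filter] at hc
      simp only [prod_mul_distrib]
      rw [prod_innerWeight_eq_prod_outerWeight (isCornerSum_of_mem_cornerSums hz).toHasBoundary
        (isCornerSum_of_mem_cornerSums hc.1).toHasBoundary]
      simp only [term]
      ring

end PairSums

theorem condensation_eq_sum_cornerSums {L : Type*} [Field L] (n : ℕ) (T : ℕ → ℕ → ℕ → L)
    (l m : ℤ → L) (hT : ∀ k i j, T k i j ≠ 0) (hT0 : ∀ i j, T 0 i j = 1)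
    (h : ∀ k N i j, k + N + 1 = n → T (k + 2) i j * T k (i + 1) (j + 1) =
      m ((i : ℤ) + j - N) * diagProd (T (k + 1)) i j +
        l ((j : ℤ) - i) * antidiagProd (T (k + 1)) i j) :
    T (n + 1) 0 0 = ∑ c ∈ cornerSums (n + 1), ∏ i ∈ range (n + 1), ∏ j ∈ range (n + 1),
      T 1 i j ^ cell c i j * cellWeight (l ((j : ℤ) - i)) (m ((i : ℤ) + j - n)) c i j := by
  have pairSum_eq (N : ℕ) : ∀ k, k + N = n →
      pairSum N (T (k + 1)) (T k) (fun i j => l ((j : ℤ) - i)) (fun i j => m ((i : ℤ) + j - N)) =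
        T (n + 1) 0 0 := by
    induction N with
    | zero =>
      rintro k rfl
      exact pairSum_zero _ _ _ _
    | succ N ih =>
      intro k hk
      have hm (i j : ℕ) : ((i + 1 : ℕ) : ℤ) + j - (N + 1 : ℕ) = (i : ℤ) + j - N := by
        push_cast
        ring
      rw [← ih (k + 1) (by omega), pairSum_succ (hT (k + 2)) (hT _) (hT _)]
      · simp only [hm]
      · intro i j
        simpa only [hm] using h k N i j (by omega)
  rw [← pairSum_eq n 0 (zero_add n), pairSum]
  refine sum_congr rfl fun c hc => ?_
  have hc := isCornerSum_of_mem_cornerSums hc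
  simp only [hT0, one_zpow, prod_const_one, mul_one]
  rw [← prod_sum_innerRange hc.toHasBoundary fun i j x => T 1 i j ^ cell c i j *
    innerWeight (m ((i : ℤ) + j - n)) (l ((j : ℤ) - i)) c i j x]
  refine prod_congr rfl fun i hi => prod_congr rfl fun j hj => ?_
  rw [← mul_sum, hc.sum_innerWeight (mem_range.1 hi) (mem_range.1 hj)]

section Alternating

variable {n : ℕ}

/-- The sum of the first `k` entries of a vector. -/
def partialSum (f : Fin n → ℤ) (k : ℕ) : ℤ := ∑ j ∈ univ.filter fun j : Fin n => (j : ℕ) < k, f j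

theorem partialSum_zero (f : Fin n → ℤ) : partialSum f 0 = 0 := by simp [partialSum]

theorem partialSum_self (f : Fin n → ℤ) : partialSum f n = ∑ j, f j := by simp [partialSum]

theorem partialSum_succ (f : Fin n → ℤ) (j : Fin n) :
    partialSum f (j + 1) = partialSum f j + f j := by
  have : univ.filter (fun k : Fin n => (k : ℕ) < j + 1) =
      insert j (univ.filter fun k : Fin n => (k : ℕ) < j) := by
    ext k
    simp only [mem_filter, mem_univ, true_and, mem_insert, Fin.ext_iff]
    omega
  rw [partialSum, this, sum_insert (by simp), add_comm, partialSum]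

theorem partialSum_eq_sub {f : Fin n → ℤ} {F : ℕ → ℤ} (h : ∀ j : Fin n, f j = F (j + 1) - F j)
    {k : ℕ} (hk : k ≤ n) : partialSum f k = F k - F 0 := by
  induction k with
  | zero => rw [partialSum_zero, sub_self]
  | succ k ih =>
    have := partialSum_succ f ⟨k, hk⟩
    simp only [h ⟨k, hk⟩] at this
    linarith [ih (by omega)]

theorem partialSum_comm (f : Fin n → Fin n → ℤ) (k l : ℕ) :
    partialSum (fun i => partialSum (f i) l) k =
      partialSum (fun j => partialSum (fun i => f i j) k) l := sum_comm

theorem partialSum_eq_of_forall_eq_zero {f : Fin n → ℤ} {k l : ℕ} (hkl : k ≤ l)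
    (h : ∀ j : Fin n, k ≤ j → (j : ℕ) < l → f j = 0) : partialSum f l = partialSum f k := by
  refine (sum_subset (fun j hj => ?_) fun j hj hj' => ?_).symm <;>
    simp only [mem_filter, mem_univ, true_and, not_lt] at *
  · omega
  · exact h j hj' hj

/-- Vectors whose nonzero entries alternate in sign, starting and ending with `1`. The encoding
is that the partial sums are `0` or `1`, the last one being `1`. -/
structure IsAlternating (b : Fin n → SignType) : Prop where
  sum_eq_one : partialSum (fun j => b j) n = 1
  bounds : ∀ k ≤ n, 0 ≤ partialSum (fun j => b j) k ∧ partialSum (fun j => b j) k ≤ 1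

theorem isAlternating_iff {b : Fin n → SignType} :
    IsAlternating b ↔ ∑ j, (b j : ℤ) = 1 ∧
      ∀ k, 0 ≤ ∑ j with j ≤ k, (b j : ℤ) ∧ ∑ j with j ≤ k, (b j : ℤ) ≤ 1 := by
  have hsum (k : Fin n) : ∑ j with j ≤ k, (b j : ℤ) = partialSum (fun j => b j) (k + 1) := by
    simp only [partialSum, Nat.lt_succ_iff, Fin.le_def]
  simp only [hsum, ← partialSum_self fun j => (b j : ℤ)]
  refine ⟨fun h => ⟨h.1, fun k => h.2 _ k.2⟩, fun h => ⟨h.1, fun k hk => ?_⟩⟩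
  rcases k with _ | k
  · simp [partialSum_zero]
  · exact h.2 ⟨k, hk⟩

theorem IsAlternating.exists_next_eq_one_iff {b : Fin n → SignType} (hb : IsAlternating b) {j : ℕ}
    (hj : j ≤ n) :
    (∃ k : Fin n, j ≤ k ∧ b k = 1 ∧ ∀ k' : Fin n, j ≤ k' → k' < k → b k' = 0) ↔
      partialSum (fun i => b i) j = 0 := by
  constructor
  · rintro ⟨k, hjk, hk, hzero⟩
    have hconst := partialSum_eq_of_forall_eq_zero (f := fun i => b i) hjk fun i hi hik => by
      simp [hzero i hi hik]
    have hsucc := partialSum_succ (fun i => b i) k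
    rw [hk, SignType.coe_one, hconst] at hsucc
    have := hb.bounds (k + 1) k.2
    have := hb.bounds j hj
    omega
  · induction hj using Nat.decreasingInduction with
    | self => exact fun h => absurd (hb.sum_eq_one.symm.trans h) one_ne_zero
    | of_succ j hj ih =>
      intro hsum
      have hsucc := partialSum_succ (fun i => b i) ⟨j, hj⟩
      rw [hsum, zero_add] at hsucc
      rcases (b ⟨j, hj⟩).trichotomy with h | h | h
      · have := hb.bounds (j + 1) hj
        simp only [h, SignType.coe_neg, SignType.coe_one] at hsucc
        omega
      · obtain ⟨k, hjk, hk, hzero⟩ := ih (by simpa [h] using hsucc)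
        refine ⟨k, by omega, hk, fun k' hjk' hk' => ?_⟩
        rcases hjk'.eq_or_lt with rfl | hlt
        · exact h
        · exact hzero k' hlt hk'
      · exact ⟨⟨j, hj⟩, le_rfl, h, fun k' hjk' hk' => absurd hjk' (not_le.2 hk')⟩

theorem IsAlternating.exists_prev_eq_one_iff {b : Fin n → SignType} (hb : IsAlternating b) {j : ℕ}
    (hj : j ≤ n) :
    (∃ k : Fin n, (k : ℕ) < j ∧ b k = 1 ∧ ∀ k' : Fin n, k < k' → (k' : ℕ) < j → b k' = 0) ↔
      partialSum (fun i => b i) j = 1 := by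
  constructor
  · rintro ⟨k, hkj, hk, hzero⟩
    have hconst : partialSum (fun i => b i) j = partialSum (fun i => b i) (k + 1) :=
      partialSum_eq_of_forall_eq_zero hkj fun i hi hij => by simp [hzero i hi hij]
    have hsucc := partialSum_succ (fun i => b i) k
    rw [hk, SignType.coe_one, ← hconst] at hsucc
    have := hb.bounds k k.2.le
    have := hb.bounds j hj
    omega
  · induction j with
    | zero => simp [partialSum_zero]
    | succ j ih =>
      intro hsum
      have hsucc := partialSum_succ (fun i => b i) ⟨j, hj⟩
      rw [hsum] at hsucc
      rcases (b ⟨j, hj⟩).trichotomy with h | h | h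
      · have := hb.bounds j (by omega)
        simp only [h, SignType.coe_neg, SignType.coe_one] at hsucc
        omega
      · obtain ⟨k, hkj, hk, hzero⟩ := ih (by omega) (by simpa [h] using hsucc.symm)
        refine ⟨k, by omega, hk, fun k' hkk' hk' => ?_⟩
        rcases (Nat.lt_succ_iff.1 hk').eq_or_lt with rfl | hlt
        · exact h
        · exact hzero k' hkk' hlt
      · exact ⟨⟨j, hj⟩, j.lt_succ_self, h, fun k' hjk' hk' =>
          absurd (Nat.lt_succ_iff.1 hk') (not_le.2 hjk')⟩

end Alternating

section SignMatrices

variable {n : ℕ} {B : Matrix (Fin n) (Fin n) SignType} {c : ℕ → ℕ → ℤ}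

theorem isASM_iff :
    IsASM B ↔ (∀ i, IsAlternating (B i)) ∧ ∀ j, IsAlternating (Matrix.transpose B j) := by
  simp only [isAlternating_iff, forall_and, IsASM, Matrix.transpose_apply]
  tauto

/-- The corner sums of a sign matrix, extended by zero. -/
def cornerSum (B : Matrix (Fin n) (Fin n) SignType) (i j : ℕ) : ℤ :=
  if n < i ∨ n < j then 0 else partialSum (fun p => partialSum (fun q => B p q) j) i

theorem cornerSum_of_le (B : Matrix (Fin n) (Fin n) SignType) {i j : ℕ} (hi : i ≤ n) (hj : j ≤ n) :
    cornerSum B i j = partialSum (fun p => partialSum (fun q => B p q) j) i :=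
  if_neg (by omega)

theorem cornerSum_transpose (B : Matrix (Fin n) (Fin n) SignType) (i j : ℕ) :
    cornerSum B.transpose i j = cornerSum B j i := by
  simp only [cornerSum, or_comm, partialSum_comm _ i j, Matrix.transpose_apply]

theorem cornerSum_succ_left (B : Matrix (Fin n) (Fin n) SignType) (i : Fin n) {j : ℕ} (hj : j ≤ n) :
    cornerSum B (i + 1) j = cornerSum B i j + partialSum (fun q => B i q) j := by
  rw [cornerSum_of_le B i.2 hj, cornerSum_of_le B i.2.le hj, partialSum_succ]

theorem cell_cornerSum (B : Matrix (Fin n) (Fin n) SignType) (i j : Fin n) :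
    cell (cornerSum B) i j = B i j := by
  rw [cell, cornerSum_succ_left B i j.2, cornerSum_succ_left B i j.2.le, partialSum_succ]
  ring

theorem cornerSum_right (hB : ∀ i, IsAlternating (B i)) {i : ℕ} (hi : i ≤ n) :
    cornerSum B i n = i := by
  rw [cornerSum_of_le B hi le_rfl, partialSum_eq_sub (F := fun k => k) _ hi]
  · simp
  · simp [(hB _).sum_eq_one]

theorem IsASM.cornerSum_mem_cornerSums (hB : IsASM B) : cornerSum B ∈ cornerSums n := by
  obtain ⟨hrow, hcol⟩ := isASM_iff.1 hB
  refine mem_cornerSums.2 ⟨⟨⟨?_, ?_, ?_, ?_⟩, ?_, ?_⟩, fun i j hij => if_pos hij⟩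
  · intro i _
    simp [cornerSum, partialSum]
  · intro j _
    simp [cornerSum, partialSum]
  · intro j hj
    rw [← cornerSum_transpose, cornerSum_right hcol hj]
  · intro i hi
    rw [cornerSum_right hrow hi]
  · intro i hi j hj
    have := cornerSum_succ_left B.transpose ⟨j, hj⟩ hi
    have := (hcol ⟨j, hj⟩).bounds i hi
    simp only [cornerSum_transpose] at *
    omega
  · intro i hi j hj
    have := cornerSum_succ_left B ⟨i, hi⟩ hj
    have := (hrow ⟨i, hi⟩).bounds j hj
    dsimp only at *
    omega

/-- The sign matrix of the second differences of an array. On corner sum arrays it is the inverse of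
`cornerSum`. -/
noncomputable def signMatrix (n : ℕ) (c : ℕ → ℕ → ℤ) : Matrix (Fin n) (Fin n) SignType :=
  fun i j => SignType.sign (cell c i j)

theorem signMatrix_swap (n : ℕ) (c : ℕ → ℕ → ℤ) :
    signMatrix n (fun i j => c j i) = (signMatrix n c).transpose := by
  ext i j
  simp only [signMatrix, cell, Matrix.transpose_apply, sub_right_comm]

theorem signMatrix_cornerSum (B : Matrix (Fin n) (Fin n) SignType) :
    signMatrix n (cornerSum B) = B := by
  ext i j
  rw [signMatrix, cell_cornerSum]
  cases B i j <;> decide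

theorem IsCornerSum.coe_signMatrix (hc : IsCornerSum n c) (i j : Fin n) :
    (signMatrix n c i j : ℤ) = cell c i j := by
  rcases hc.cell_cases i.2 j.2 with h | h | h | h | h | h <;> simp [signMatrix, h.2.2.2]

theorem IsCornerSum.partialSum_signMatrix (hc : IsCornerSum n c) (i : Fin n) {k : ℕ} (hk : k ≤ n) :
    partialSum (fun j => signMatrix n c i j) k = c (i + 1) k - c i k := by
  rw [partialSum_eq_sub (F := fun k => c (i + 1) k - c i k) _ hk]
  · simp [hc.left i i.2.le, hc.left (i + 1) i.2]
  · intro j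
    rw [hc.coe_signMatrix, cell]
    ring

theorem cornerSum_signMatrix (hc : c ∈ cornerSums n) : cornerSum (signMatrix n c) = c := by
  obtain ⟨hc, hzero⟩ := mem_cornerSums.1 hc
  funext i j
  by_cases hij : n < i ∨ n < j
  · rw [hzero i j hij, cornerSum, if_pos hij]
  · push Not at hij
    rw [cornerSum_of_le _ hij.1 hij.2,
      partialSum_eq_sub (F := fun i => c i j) (fun i => hc.partialSum_signMatrix i hij.2) hij.1,
      hc.top j hij.2, sub_zero]

theorem IsCornerSum.isAlternating_signMatrix (hc : IsCornerSum n c) (i : Fin n) :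
    IsAlternating (signMatrix n c i) where
  sum_eq_one := by
    rw [hc.partialSum_signMatrix i le_rfl, hc.right i i.2.le, hc.right (i + 1) i.2]
    simp
  bounds k hk := by
    rw [hc.partialSum_signMatrix i hk]
    have := hc.col i i.2 k hk
    omega

theorem IsCornerSum.isASM_signMatrix (hc : IsCornerSum n c) : IsASM (signMatrix n c) := by
  refine isASM_iff.2 ⟨hc.isAlternating_signMatrix, ?_⟩
  rw [← signMatrix_swap]
  exact hc.swap.isAlternating_signMatrix

theorem IsCornerSum.rightIsOne_signMatrix_iff (hc : IsCornerSum n c) (i j : Fin n) :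
    RightIsOne (signMatrix n c) i j ↔ c (i + 1) (j + 1) = c i (j + 1) := by
  rw [← sub_eq_zero, ← hc.partialSum_signMatrix i j.2]
  exact (hc.isAlternating_signMatrix i).exists_next_eq_one_iff j.2

theorem IsCornerSum.belowIsOne_signMatrix_iff (hc : IsCornerSum n c) (i j : Fin n) :
    BelowIsOne (signMatrix n c) i j ↔ c (i + 1) (j + 1) = c (i + 1) j := by
  rw [← hc.swap.rightIsOne_signMatrix_iff j i, signMatrix_swap]
  rfl

theorem IsCornerSum.aboveIsOne_signMatrix_iff (hc : IsCornerSum n c) (i j : Fin n) :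
    AboveIsOne (signMatrix n c) i j ↔ c i (j + 1) = c i j + 1 := by
  rw [← sub_eq_iff_eq_add', ← hc.swap.partialSum_signMatrix j i.2.le,
    ← (hc.swap.isAlternating_signMatrix j).exists_prev_eq_one_iff i.2.le, signMatrix_swap n c]
  rfl

end SignMatrices

section SumOverASMs

section CommMonoid

variable {L : Type*} [CommMonoid L] {n : ℕ}

theorem prod_pow_card_filter {ι : Type*} [Fintype ι] (f : ι → ℤ) (p : ι → Prop)
    [DecidablePred p] (s : Finset ℤ) (l : ℤ → L) (h : ∀ i, p i → f i ∈ s) :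
    ∏ a ∈ s, l a ^ #{i | f i = a ∧ p i} = ∏ i, if p i then l (f i) else 1 := by
  calc
    _ = ∏ a ∈ s, ∏ i with p i, if f i = a then l a else 1 := by
      refine prod_congr rfl fun a _ => ?_
      simp only [← prod_const, ← prod_filter, filter_filter, and_comm]
    _ = _ := by
      rw [prod_comm, ← prod_filter]
      refine prod_congr rfl fun i hi => ?_
      rw [prod_ite_eq, if_pos (h i (mem_filter.1 hi).2)]

theorem prod_pow_diagCount (B : Matrix (Fin n) (Fin n) SignType) (l : ℤ → L) :
    ∏ a ∈ Icc (2 - (n : ℤ)) (n - 2), l a ^ diagCount B a = ∏ i, ∏ j,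
      if B i j = 0 ∧ RightIsOne B i j ∧ BelowIsOne B i j then l (diagIdx i j) else 1 := by
  rw [← Fintype.prod_prod_type']
  refine prod_pow_card_filter (fun p : Fin n × Fin n => diagIdx p.1 p.2) _ _ l ?_
  rintro ⟨i, j⟩ ⟨-, ⟨k, hk, -⟩, k', hk', -⟩
  simp only [diagIdx, mem_Icc]
  dsimp only at hk hk'
  omega

theorem prod_pow_antiCount (B : Matrix (Fin n) (Fin n) SignType) (m : ℤ → L) :
    ∏ a ∈ Icc (2 - (n : ℤ)) (n - 2), m a ^ antiCount B a = ∏ i, ∏ j,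
      if B i j = 0 ∧ RightIsOne B i j ∧ AboveIsOne B i j then m (antiIdx i j) else 1 := by
  rw [← Fintype.prod_prod_type']
  refine prod_pow_card_filter (fun p : Fin n × Fin n => antiIdx p.1 p.2) _ _ m ?_
  rintro ⟨i, j⟩ ⟨-, ⟨k, hk, -⟩, k', hk', -⟩
  simp only [antiIdx, mem_Icc]
  dsimp only at hk hk'
  omega

end CommMonoid

theorem asmSum_eq_sum_cornerSums {L : Type*} [Field L] {n : ℕ} (a : ℕ → ℕ → L)
    (l m : ℤ → L) :
    asmSum (fun i j : Fin n => a i j) l m = ∑ c ∈ cornerSums n, ∏ i ∈ range n, ∏ j ∈ range n,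
      a i j ^ cell c i j * cellWeight (l ((j : ℤ) - i)) (m ((i : ℤ) + j - n + 1)) c i j := by
  symm
  refine sum_bij' (fun c _ => signMatrix n c) (fun B _ => cornerSum B)
    (fun c hc => mem_filter.2 ⟨mem_univ _, (isCornerSum_of_mem_cornerSums hc).isASM_signMatrix⟩)
    (fun B hB => (mem_filter.1 hB).2.cornerSum_mem_cornerSums)
    (fun c hc => cornerSum_signMatrix hc) (fun B _ => signMatrix_cornerSum B) fun c hc => ?_
  have hc := isCornerSum_of_mem_cornerSums hc
  simp only [prod_mul_distrib (s := Icc _ _), prod_pow_diagCount, prod_pow_antiCount, prod_range,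
    ← prod_mul_distrib]
  refine prod_congr rfl fun i _ => prod_congr rfl fun j _ => ?_
  have hzero : signMatrix n c i j = 0 ↔ cell c i j = 0 := sign_eq_zero_iff
  have hneg : signMatrix n c i j = -1 ↔ cell c i j = -1 := by
    rw [← hc.coe_signMatrix]
    cases signMatrix n c i j <;> decide
  have hanti : antiIdx i j = (i : ℤ) + j - n + 1 := by
    unfold antiIdx
    ring
  simp only [cellWeight, hzero, hneg, hanti, diagIdx, hc.coe_signMatrix,
    hc.rightIsOne_signMatrix_iff, hc.belowIsOne_signMatrix_iff, hc.aboveIsOne_signMatrix_iff,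
    pow_ite, pow_one, pow_zero]
  ring

end SumOverASMs

section Specialization

variable {K : Type*} [Field K] {N : ℕ} {x : Vars N → K} {r r' : RatFun K N} {v v' : K}

theorem algebraMap_ne_zero_of_eval_ne_zero {Q : MvPolynomial (Vars N) K}
    (hQ : MvPolynomial.eval x Q ≠ 0) : algebraMap (MvPolynomial (Vars N) K) (RatFun K N) Q ≠ 0 := by
  intro h
  rw [map_eq_zero_iff _ (IsFractionRing.injective (MvPolynomial (Vars N) K) (RatFun K N))] at h
  exact hQ (by rw [h, map_zero])

theorem hasValueAt_algebraMap (P : MvPolynomial (Vars N) K) :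
    HasValueAt (algebraMap _ (RatFun K N) P) x (MvPolynomial.eval x P) :=
  ⟨P, 1, by simp, by simp, by simp⟩

theorem hasValueAt_var (a : Vars N) : HasValueAt (var K N a) x (x a) := by
  have h := hasValueAt_algebraMap (x := x) (MvPolynomial.X a)
  rwa [MvPolynomial.eval_X] at h

theorem hasValueAt_one : HasValueAt (1 : RatFun K N) x 1 := by
  simpa using hasValueAt_algebraMap (x := x) 1

theorem hasValueAt_zero : HasValueAt (0 : RatFun K N) x 0 := by
  simpa using hasValueAt_algebraMap (x := x) 0

theorem HasValueAt.add (h : HasValueAt r x v) (h' : HasValueAt r' x v') :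
    HasValueAt (r + r') x (v + v') := by
  obtain ⟨P, Q, hQ, rfl, rfl⟩ := h
  obtain ⟨P', Q', hQ', rfl, rfl⟩ := h'
  refine ⟨P * Q' + Q * P', Q * Q', by simp [hQ, hQ'], ?_, ?_⟩
  · rw [div_add_div _ _ (algebraMap_ne_zero_of_eval_ne_zero hQ)
      (algebraMap_ne_zero_of_eval_ne_zero hQ')]
    simp only [map_add, map_mul]
  · rw [div_add_div _ _ hQ hQ']
    simp only [map_add, map_mul]

theorem HasValueAt.mul (h : HasValueAt r x v) (h' : HasValueAt r' x v') :
    HasValueAt (r * r') x (v * v') := by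
  obtain ⟨P, Q, hQ, rfl, rfl⟩ := h
  obtain ⟨P', Q', hQ', rfl, rfl⟩ := h'
  refine ⟨P * P', Q * Q', by simp [hQ, hQ'], ?_, ?_⟩ <;> rw [div_mul_div_comm] <;>
    simp only [map_mul]

theorem HasValueAt.inv (h : HasValueAt r x v) (hv : v ≠ 0) : HasValueAt r⁻¹ x v⁻¹ := by
  obtain ⟨P, Q, _, rfl, rfl⟩ := h
  exact ⟨Q, P, fun h => hv (by simp [h]), inv_div _ _, inv_div _ _⟩

theorem HasValueAt.div (h : HasValueAt r x v) (h' : HasValueAt r' x v') (hv : v' ≠ 0) :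
    HasValueAt (r / r') x (v / v') := by
  rw [div_eq_mul_inv, div_eq_mul_inv]
  exact h.mul (h'.inv hv)

theorem HasValueAt.ne_zero (h : HasValueAt r x v) (hv : v ≠ 0) : r ≠ 0 := by
  obtain ⟨P, Q, hQ, rfl, rfl⟩ := h
  exact div_ne_zero (algebraMap_ne_zero_of_eval_ne_zero (x := x) fun h => hv (by simp [h]))
    (algebraMap_ne_zero_of_eval_ne_zero hQ)

theorem HasValueAt.unique (h : HasValueAt r x v) (h' : HasValueAt r x v') : v = v' := by
  obtain ⟨P, Q, hQ, rfl, rfl⟩ := h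
  obtain ⟨P', Q', hQ', hPQ, rfl⟩ := h'
  rw [div_eq_div_iff (algebraMap_ne_zero_of_eval_ne_zero hQ)
    (algebraMap_ne_zero_of_eval_ne_zero hQ'), ← map_mul, ← map_mul] at hPQ
  rw [div_eq_div_iff hQ hQ', ← map_mul, ← map_mul]
  exact congrArg _ (IsFractionRing.injective (MvPolynomial (Vars N) K) (RatFun K N) hPQ)

/-- The graph of the evaluation at `x`, as a semiring of pairs of a rational function regular at `x`
and its value there. It makes finite sums and products compatible with evaluation. -/
def evalGraph (x : Vars N → K) : Subsemiring (RatFun K N × K) where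
  carrier := {p | HasValueAt p.1 x p.2}
  mul_mem' := HasValueAt.mul
  one_mem' := hasValueAt_one
  add_mem' := HasValueAt.add
  zero_mem' := hasValueAt_zero

theorem HasValueAt.sum {ι : Type*} {s : Finset ι} {f : ι → RatFun K N} {g : ι → K}
    (h : ∀ i ∈ s, HasValueAt (f i) x (g i)) : HasValueAt (∑ i ∈ s, f i) x (∑ i ∈ s, g i) := by
  have hmem := sum_mem (S := evalGraph x) (f := fun i => (f i, g i)) h
  rwa [← prod_mk_sum] at hmem

theorem HasValueAt.prod {ι : Type*} {s : Finset ι} {f : ι → RatFun K N} {g : ι → K}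
    (h : ∀ i ∈ s, HasValueAt (f i) x (g i)) : HasValueAt (∏ i ∈ s, f i) x (∏ i ∈ s, g i) := by
  have hmem := prod_mem (S := evalGraph x) (f := fun i => (f i, g i)) h
  rwa [← prod_mk_prod] at hmem

theorem HasValueAt.pow (h : HasValueAt r x v) (k : ℕ) : HasValueAt (r ^ k) x (v ^ k) :=
  pow_mem (S := evalGraph x) (x := (r, v)) h k

theorem HasValueAt.zpow_coe_signType (h : HasValueAt r x v) (s : SignType) (hs : s = -1 → v ≠ 0) :
    HasValueAt (r ^ (s : ℤ)) x (v ^ (s : ℤ)) := by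
  rcases s.trichotomy with rfl | rfl | rfl
  · simpa using h.inv (hs rfl)
  · simpa using hasValueAt_one
  · simpa using h

theorem IsDefined.isDefined_and_hasValueAt : ∀ {n : ℕ} {R : Matrix (Fin n) (Fin n) (RatFun K N)}
    {ρ σ : ℤ → RatFun K N} {A : Matrix (Fin n) (Fin n) K} {l m : ℤ → K}, IsDefined n A l m →
    (∀ i j, HasValueAt (R i j) x (A i j)) → (∀ a, HasValueAt (ρ a) x (l a)) →
    (∀ a, HasValueAt (σ a) x (m a)) →
    IsDefined n R ρ σ ∧ HasValueAt (lambdaDet n R ρ σ) x (lambdaDet n A l m)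
  | 0, _, _, _, _, _, _, _, _, _, _ => ⟨trivial, hasValueAt_one⟩
  | 1, _, _, _, _, _, _, _, hA, _, _ => ⟨trivial, hA 0 0⟩
  | n + 2, _, _, _, _, _, _, ⟨hFF, hLL, hFL, hLF, hcenter, hne⟩, hA, hl, hm => by
    obtain ⟨dFF, vFF⟩ := hFF.isDefined_and_hasValueAt
      (fun i j => hA i.succ j.succ) hl (fun a => hm (a + 1))
    obtain ⟨dLL, vLL⟩ := hLL.isDefined_and_hasValueAt
      (fun i j => hA i.castSucc j.castSucc) hl (fun a => hm (a - 1))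
    obtain ⟨dFL, vFL⟩ := hFL.isDefined_and_hasValueAt
      (fun i j => hA i.succ j.castSucc) (fun a => hl (a - 1)) hm
    obtain ⟨dLF, vLF⟩ := hLF.isDefined_and_hasValueAt
      (fun i j => hA i.castSucc j.succ) (fun a => hl (a + 1)) hm
    obtain ⟨dcenter, vcenter⟩ := hcenter.isDefined_and_hasValueAt
      (fun i j => hA i.castSucc.succ j.castSucc.succ) hl hm
    exact ⟨⟨dFF, dLL, dFL, dLF, dcenter, vcenter.ne_zero hne⟩,
      ((((hm 0).mul vFF).mul vLL).add (((hl 0).mul vFL).mul vLF)).div vcenter hne⟩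

end Specialization

section Condensation

variable {L : Type*}

/-- The contiguous `k × k` block of an array with upper left corner `(i, j)`. -/
def block (a : ℕ → ℕ → L) (k i j : ℕ) : Matrix (Fin k) (Fin k) L :=
  fun p q => a (i + p) (j + q)

theorem eraseFF_block (a : ℕ → ℕ → L) (k i j : ℕ) :
    eraseFF (block a (k + 1) i j) = block a k (i + 1) (j + 1) := by
  ext p q
  simp [eraseFF, block, add_comm, add_left_comm]

theorem eraseLL_block (a : ℕ → ℕ → L) (k i j : ℕ) :
    eraseLL (block a (k + 1) i j) = block a k i j := rfl

theorem eraseFL_block (a : ℕ → ℕ → L) (k i j : ℕ) :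
    eraseFL (block a (k + 1) i j) = block a k (i + 1) j := by
  ext p q
  simp [eraseFL, block, add_comm, add_left_comm]

theorem eraseLF_block (a : ℕ → ℕ → L) (k i j : ℕ) :
    eraseLF (block a (k + 1) i j) = block a k i (j + 1) := by
  ext p q
  simp [eraseLF, block, add_comm, add_left_comm]

variable [Field L]

theorem lambdaDet_add_two (n : ℕ) (A : Matrix (Fin (n + 2)) (Fin (n + 2)) L) (l m : ℤ → L) :
    lambdaDet (n + 2) A l m =
      (m 0 * lambdaDet (n + 1) (eraseFF A) l (shift m) *
          lambdaDet (n + 1) (eraseLL A) l (unshift m) +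
        l 0 * lambdaDet (n + 1) (eraseFL A) (unshift l) m *
          lambdaDet (n + 1) (eraseLF A) (shift l) m) /
        lambdaDet n (eraseLL (eraseFF A)) l m := rfl

theorem isDefined_one_and_lambdaDet_one : ∀ n : ℕ,
    IsDefined (K := L) n (fun _ _ => 1) (fun _ => 0) (fun _ => 1) ∧
      lambdaDet (K := L) n (fun _ _ => 1) (fun _ => 0) (fun _ => 1) = 1
  | 0 => ⟨trivial, rfl⟩
  | 1 => ⟨trivial, rfl⟩
  | n + 2 => by
    let D (k : ℕ) : L := lambdaDet k (fun _ _ => 1) (fun _ => 0) fun _ => 1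
    have hrec : D (n + 2) = (1 * D (n + 1) * D (n + 1) + 0 * D (n + 1) * D (n + 1)) / D n := rfl
    obtain ⟨h₁, hD₁ : D (n + 1) = 1⟩ := isDefined_one_and_lambdaDet_one (n + 1)
    obtain ⟨h₀, hD₀ : D n = 1⟩ := isDefined_one_and_lambdaDet_one n
    refine ⟨⟨h₁, h₁, h₁, h₁, h₀, hD₀.trans_ne one_ne_zero⟩, hrec.trans ?_⟩
    rw [hD₁, hD₀]
    norm_num

/-- The generalized Lambda-determinant of the contiguous `k × k` block with upper left corner
`(i, j)`, with the shifts of the parameters under which this block occurs in the recursion for the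
`n × n` block with upper left corner `(0, 0)`. -/
def blockDet (a : ℕ → ℕ → L) (l m : ℤ → L) (n k i j : ℕ) : L :=
  lambdaDet k (block a k i j) (fun s => l (s + (j - i))) (fun s => m (s + (i + j + k - n)))

theorem blockDet_self (a : ℕ → ℕ → L) (l m : ℤ → L) (n : ℕ) :
    blockDet a l m n n 0 0 = lambdaDet n (fun i j => a i j) l m := by
  have hblock : block a n 0 0 = fun i j : Fin n => a i j := by
    ext i j
    simp [block]
  simp [blockDet, hblock]

theorem blockDet_add_two_mul {a : ℕ → ℕ → L} {l m : ℤ → L} {n k i j : ℕ}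
    (h : blockDet a l m n k (i + 1) (j + 1) ≠ 0) :
    blockDet a l m n (k + 2) i j * blockDet a l m n k (i + 1) (j + 1) =
      m (i + j + k + 2 - n) * diagProd (blockDet a l m n (k + 1)) i j +
        l (j - i) * antidiagProd (blockDet a l m n (k + 1)) i j := by
  have hrec : blockDet a l m n (k + 2) i j =
      (m (i + j + k + 2 - n) * blockDet a l m n (k + 1) (i + 1) (j + 1) *
          blockDet a l m n (k + 1) i j +
        l (j - i) * blockDet a l m n (k + 1) (i + 1) j * blockDet a l m n (k + 1) i (j + 1)) /
        blockDet a l m n k (i + 1) (j + 1) := by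
    unfold blockDet
    rw [lambdaDet_add_two, eraseFF_block, eraseLL_block, eraseFL_block, eraseLF_block,
      eraseLL_block]
    unfold shift unshift
    push_cast
    ring_nf
  rw [hrec, div_mul_cancel₀ _ h, diagProd, antidiagProd]
  ring

theorem lambdaDet_eq_asmSum_of_blockDet_ne_zero {a : ℕ → ℕ → L} {l m : ℤ → L} {n : ℕ}
    (h : ∀ k i j, blockDet a l m n k i j ≠ 0) :
    lambdaDet n (fun i j => a i j) l m = asmSum (fun i j : Fin n => a i j) l m := by
  rw [asmSum_eq_sum_cornerSums]
  rcases n with _ | n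
  · rw [cornerSums_eq_singleton zero_le_one]
    simp [lambdaDet]
  · rw [← blockDet_self, condensation_eq_sum_cornerSums n (blockDet a l m (n + 1)) l m h
      fun _ _ => rfl]
    · refine sum_congr rfl fun c _ => prod_congr rfl fun i _ => prod_congr rfl fun j _ => ?_
      have hindex : (i : ℤ) + j - (n + 1 : ℕ) + 1 = i + j - n := by
        push_cast
        ring
      rw [hindex]
      rfl
    · rintro k N i j rfl
      have hindex : (i : ℤ) + j + k + 2 - (k + N + 1 + 1 : ℕ) = i + j - N := by
        push_cast
        ring
      rw [blockDet_add_two_mul (h _ _ _), hindex]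

end Condensation

section Interior

/-- Row or column indices that are neither the first nor the last one. -/
def IsInterior {n : ℕ} (i : Fin n) : Prop := 0 < (i : ℕ) ∧ (i : ℕ) + 1 < n

/-- The matrices all of whose entries away from the border are nonzero. -/
def InteriorNonzero {K : Type*} [Zero K] {n : ℕ} (A : Matrix (Fin n) (Fin n) K) : Prop :=
  ∀ i j, IsInterior i → IsInterior j → A i j ≠ 0

theorem IsInterior.exists_succ_or_castSucc {n : ℕ} {i : Fin (n + 4)} (hi : IsInterior i) :
    ∃ p : Fin (n + 3), IsInterior p ∧ (p.succ = i ∨ p.castSucc = i) := by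
  obtain ⟨i, hin⟩ := i
  obtain ⟨hpos, hlt⟩ := hi
  dsimp only at hpos hlt
  by_cases h : i = 1
  · exact ⟨⟨i, by omega⟩, ⟨hpos, by dsimp only; omega⟩, Or.inr rfl⟩
  · exact ⟨⟨i - 1, by omega⟩, ⟨by dsimp only; omega, by dsimp only; omega⟩,
      Or.inl (Fin.ext (Nat.sub_add_cancel hpos))⟩

theorem IsDefined.interiorNonzero {K : Type*} [Field K] : ∀ {n : ℕ}
    {A : Matrix (Fin n) (Fin n) K} {l m : ℤ → K}, IsDefined n A l m → InteriorNonzero A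
  | 0, _, _, _, _, i, _, _, _ => i.elim0
  | 1, _, _, _, _, _, _, ⟨_, _⟩, _ => by omega
  | 2, _, _, _, _, _, _, ⟨_, _⟩, _ => by omega
  | 3, _, _, _, ⟨_, _, _, _, _, hne⟩, i, j, ⟨_, _⟩, ⟨_, _⟩ => by
    obtain rfl : i = 1 := by omega
    obtain rfl : j = 1 := by omega
    exact hne
  | _ + 4, _, _, _, ⟨hFF, hLL, hFL, hLF, _, _⟩, i, j, hi, hj => by
    obtain ⟨p, hp, rfl | rfl⟩ := hi.exists_succ_or_castSucc <;>
      obtain ⟨q, hq, rfl | rfl⟩ := hj.exists_succ_or_castSucc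
    · exact hFF.interiorNonzero p q hp hq
    · exact hFL.interiorNonzero p q hp hq
    · exact hLF.interiorNonzero p q hp hq
    · exact hLL.interiorNonzero p q hp hq

theorem IsASM.isInterior_of_eq_neg_one {n : ℕ} {B : Matrix (Fin n) (Fin n) SignType} (hB : IsASM B)
    {i j : Fin n} (h : B i j = -1) : IsInterior i ∧ IsInterior j := by
  have hrow {B : Matrix (Fin n) (Fin n) SignType} (hB : IsASM B) {i j : Fin n}
      (h : B i j = -1) : IsInterior i :=
    (isCornerSum_of_mem_cornerSums hB.cornerSum_mem_cornerSums).interior_row_of_cell_eq_neg_one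
      i.2 j.2 (by rw [cell_cornerSum, h, SignType.coe_neg, SignType.coe_one])
  exact ⟨hrow hB h, hrow (B := B.transpose) (isASM_iff.2 (isASM_iff.1 hB).symm) h⟩

end Interior

section Generic

variable {K : Type*} [Field K] {n : ℕ}

theorem isDefined_gen_and_hasValueAt_lambdaDet_gen {A : Matrix (Fin n) (Fin n) K} {l m : ℤ → K}
    (h : IsDefined n A l m) :
    IsDefined n (genMatrix K n) (genLambda K n) (genMu K n) ∧
      HasValueAt (lambdaDet n (genMatrix K n) (genLambda K n) (genMu K n)) (point A l m)
        (lambdaDet n A l m) :=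
  h.isDefined_and_hasValueAt (fun _ _ => hasValueAt_var _) (fun _ => hasValueAt_var _)
    fun _ => hasValueAt_var _

theorem hasValueAt_asmSum_gen {A : Matrix (Fin n) (Fin n) K} (hA : InteriorNonzero A)
    (l m : ℤ → K) :
    HasValueAt (asmSum (genMatrix K n) (genLambda K n) (genMu K n)) (point A l m)
      (asmSum A l m) := by
  have hl (a : ℤ) : HasValueAt (genLambda K n a) (point A l m) (l a) := hasValueAt_var _
  have hm (a : ℤ) : HasValueAt (genMu K n a) (point A l m) (m a) := hasValueAt_var _
  have hentry (i j : Fin n) : HasValueAt (genMatrix K n i j) (point A l m) (A i j) :=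
    hasValueAt_var _
  refine HasValueAt.sum fun B hB =>
    (HasValueAt.prod fun a _ => ((hl a).pow _).mul ((hm a).pow _)).mul
      (HasValueAt.prod fun i _ => HasValueAt.prod fun j _ => ?_)
  refine ((hentry i j).zpow_coe_signType _ fun h => ?_).mul (((hl _).add (hm _)).pow _)
  obtain ⟨hi, hj⟩ := (mem_filter.1 hB).2.isInterior_of_eq_neg_one h
  exact hA i j hi hj

variable (K n) in
theorem isDefined_gen : IsDefined n (genMatrix K n) (genLambda K n) (genMu K n) :=
  (isDefined_gen_and_hasValueAt_lambdaDet_gen (isDefined_one_and_lambdaDet_one n).1).1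

variable (K n) in
theorem lambdaDet_gen_eq_asmSum :
    lambdaDet n (genMatrix K n) (genLambda K n) (genMu K n) =
      asmSum (genMatrix K n) (genLambda K n) (genMu K n) := by
  let a (i j : ℕ) : RatFun K n :=
    if h : i < n ∧ j < n then genMatrix K n ⟨i, h.1⟩ ⟨j, h.2⟩ else 1
  let x : Vars n → K := point (fun _ _ => 1) (fun _ => 0) (fun _ => 1)
  have ha (i j : ℕ) : HasValueAt (a i j) x 1 := by
    simp only [a]
    split_ifs
    exacts [hasValueAt_var _, hasValueAt_one]
  have hdet (k i j : ℕ) : blockDet a (genLambda K n) (genMu K n) n k i j ≠ 0 := by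
    obtain ⟨hone, hvalue⟩ := isDefined_one_and_lambdaDet_one (L := K) k
    refine (hone.isDefined_and_hasValueAt (x := x) (fun _ _ => ha _ _)
      (fun _ => hasValueAt_var _) fun _ => hasValueAt_var _).2.ne_zero ?_
    exact hvalue.trans_ne one_ne_zero
  have hgen : genMatrix K n = fun i j : Fin n => a i j := by
    ext i j
    simp [a]
  rw [hgen]
  exact lambdaDet_eq_asmSum_of_blockDet_ne_zero hdet

theorem hasValueAt_lambdaDet_gen {A : Matrix (Fin n) (Fin n) K} (hA : InteriorNonzero A)
    (l m : ℤ → K) :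
    HasValueAt (lambdaDet n (genMatrix K n) (genLambda K n) (genMu K n)) (point A l m)
      (asmSum A l m) :=
  lambdaDet_gen_eq_asmSum K n ▸ hasValueAt_asmSum_gen hA l m

end Generic

end LambdaDet

theorem mainTheorem2 {K : Type*} [Field K] (n : ℕ) :
    -- the formula holds whenever the recursive definition makes sense
    (∀ (A : Matrix (Fin n) (Fin n) K) (l m : ℤ → K), LambdaDet.IsDefined n A l m →
      LambdaDet.lambdaDet n A l m = LambdaDet.asmSum A l m) ∧
    -- the recursive definition makes sense for indeterminate entries and parameters, and the
    -- formula is an identity of rational functions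
    (LambdaDet.IsDefined n (LambdaDet.genMatrix K n) (LambdaDet.genLambda K n)
        (LambdaDet.genMu K n) ∧
      LambdaDet.lambdaDet n (LambdaDet.genMatrix K n) (LambdaDet.genLambda K n)
        (LambdaDet.genMu K n) =
      LambdaDet.asmSum (LambdaDet.genMatrix K n) (LambdaDet.genLambda K n)
        (LambdaDet.genMu K n)) ∧
    -- that rational function is regular, with the value given by the formula, at every matrix
    -- whose entries away from the border do not vanish
    (∀ (A : Matrix (Fin n) (Fin n) K) (l m : ℤ → K),
      (∀ i j : Fin n, 0 < (i : ℕ) → (i : ℕ) + 1 < n → 0 < (j : ℕ) → (j : ℕ) + 1 < n →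
        A i j ≠ 0) →
      LambdaDet.HasValueAt
        (LambdaDet.lambdaDet n (LambdaDet.genMatrix K n) (LambdaDet.genLambda K n)
          (LambdaDet.genMu K n))
        (LambdaDet.point A l m) (LambdaDet.asmSum A l m)) := by
  refine ⟨fun A l m h => ?_, ⟨LambdaDet.isDefined_gen K n, LambdaDet.lambdaDet_gen_eq_asmSum K n⟩,
    fun A l m hA => LambdaDet.hasValueAt_lambdaDet_gen (fun i j hi hj =>
      hA i j hi.1 hi.2 hj.1 hj.2) l m⟩
  have hdet := (LambdaDet.isDefined_gen_and_hasValueAt_lambdaDet_gen h).2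
  exact hdet.unique (LambdaDet.hasValueAt_lambdaDet_gen h.interiorNonzero l m)
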